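/- Let $R$ be an excellent integral domain of characteristic zero (in particular, $R$ is commutative and noetherian). Denote by $\operatorname{mod} R$ the category of finitely generated $R$-modules. A strictly full subcategory $\mathcal X$ of $\operatorname{mod} R$ (that is, a full subcategory closed under isomorphisms) is called IKE-closed if the image and the kernel of every homomorphism between modules in $\mathcal X$ belong to $\mathcal X$, and if for every exact sequence $0\to L\to M\to N\to 0$ in $\operatorname{mod} R$ with $L,N\in\mathcal X$ one has $M\in\mathcal X$. Put $\operatorname{Ass}\mathcal X=\bigcup_{X\in\mathcal X}\operatorname{Ass}_R X$, and let $\operatorname{tf} R$ be the subcategory of $\operatorname{mod} R$ consisting of the torsionfree modules. (1) Let $S$ be the integral closure of $R$ in its field of fractions, and let $\mathcal X$ be an IKE-closed subcategory of $\operatorname{mod} R$ with $\operatorname{Ass}\mathcal X=\{0\}$, where $0$ is the zero ideal of $R$. Then every finitely generated torsionfree $S$-module, regarded as an $R$-module, belongs to $\mathcal X$ (in particular, it is finitely generated over $R$), and for every finitely generated $S$-module $N$ the $R$-module $\operatorname{Hom}_R(N,R)$ belongs to $\mathcal X$. (2) If moreover $R$ is normal, i.e. integrally closed in its field of fractions,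 then there is no IKE-closed subcategory $\mathcal X$ of $\operatorname{mod} R$ with $0\subsetneq\mathcal X\subsetneq\operatorname{tf} R$, where $0$ is the subcategory of zero modules. -/

import Mathlib

open CategoryTheory TensorProduct

universe u

/-! ### Excellent rings -/

/-- The regular locus of `Spec A`. -/
def regularLocus (A : Type u) [CommRing A] : Set (PrimeSpectrum A) :=
  {q | IsRegularLocalRing (Localization.AtPrime q.asIdeal)}

/-- A (noetherian) ring is J-2 if every algebra of finite type over it has open regular locus. -/
def IsJTwoRing (A : Type u) [CommRing A] : Prop :=
  ∀ (B : Type u) [CommRing B] [Algebra A B], Algebra.FiniteType A B → IsOpen (regularLocus B)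

/-- An algebra `A` over a field `k` is geometrically regular if `K ⊗ A` is a (noetherian) regular
ring for all finite field extensions `K / k`. -/
def IsGeometricallyRegular (k A : Type u) [Field k] [CommRing A] [Algebra k A] : Prop :=
  ∀ (K : Type u) [Field K] [Algebra k K], FiniteDimensional k K → IsRegularRing (K ⊗[k] A)

/-- A ring homomorphism `A → B` is regular if it is flat and all of its fibres
`κ(q) ⊗ B` are geometrically regular over `κ(q)`. -/
def IsRegularHom (A B : Type u) [CommRing A] [CommRing B] [Algebra A B] : Prop :=
  Module.Flat A B ∧
    ∀ (q : Ideal A) [q.IsPrime], IsGeometricallyRegular q.ResidueField (q.ResidueField ⊗[A] B)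

/-- A (noetherian) ring is a G-ring if for each prime ideal `p` the map from `A_p` to its
completion with respect to its maximal ideal is regular. -/
def IsGrothendieckRing (A : Type u) [CommRing A] : Prop :=
  ∀ (p : Ideal A) [p.IsPrime],
    IsRegularHom (Localization.AtPrime p)
      (AdicCompletion (IsLocalRing.maximalIdeal (Localization.AtPrime p))
        (Localization.AtPrime p))

/-- A (noetherian) ring is catenary if any two saturated chains of prime ideals with the same
endpoints have the same length. -/
def IsCatenaryRing (A : Type u) [CommRing A] : Prop :=
  ∀ c d : RelSeries {(p, q) : PrimeSpectrum A × PrimeSpectrum A | p ⋖ q},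
    c.head = d.head → c.last = d.last → c.length = d.length

/-- A (noetherian) ring is universally catenary if all algebras of finite type over it are
catenary. -/
def IsUniversallyCatenaryRing (A : Type u) [CommRing A] : Prop :=
  ∀ (B : Type u) [CommRing B] [Algebra A B], Algebra.FiniteType A B → IsCatenaryRing B

/-- Excellent rings: noetherian universally catenary G-rings that are J-2. -/
structure IsExcellentRing (A : Type u) [CommRing A] : Prop where
  isNoetherianRing : IsNoetherianRing A
  isUniversallyCatenaryRing : IsUniversallyCatenaryRing A
  isGrothendieckRing : IsGrothendieckRing A
  isJTwoRing : IsJTwoRing A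

/-! ### Subcategories of the category `mod R` of finitely generated modules

A full subcategory of `mod R` is given by an object property `X` of `R`-modules all of whose
members are finitely generated. -/

section Subcategories

variable {R : Type u} [CommRing R]

/-- `X` is a strictly full subcategory of `mod R` that is closed under images, kernels and
extensions (for a noetherian ring `R`). -/
structure IsIKEClosed (X : ObjectProperty (ModuleCat.{u} R)) : Prop where
  le_isFG : X ≤ ModuleCat.isFG R
  of_iso : ∀ {M N : ModuleCat.{u} R}, (M ≅ N) → X M → X N
  image : ∀ {M N : ModuleCat.{u} R} (f : M →ₗ[R] N), X M → X N →
    X (ModuleCat.of R (LinearMap.range f))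
  kernel : ∀ {M N : ModuleCat.{u} R} (f : M →ₗ[R] N), X M → X N →
    X (ModuleCat.of R (LinearMap.ker f))
  extension : ∀ {L M N : ModuleCat.{u} R} (f : L →ₗ[R] M) (g : M →ₗ[R] N),
    Function.Injective f → Function.Exact f g → Function.Surjective g → X L → X N → X M

/-- `Ass X`, the union of the sets of associated primes of the modules in `X`. -/
def assPrimes (X : ObjectProperty (ModuleCat.{u} R)) : Set (Ideal R) :=
  {p | ∃ M : ModuleCat.{u} R, X M ∧ p ∈ associatedPrimes R M}

variable (R) in
/-- `tf R`, the subcategory of finitely generated torsionfree modules. -/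
def torsionfreeModules : ObjectProperty (ModuleCat.{u} R) :=
  fun M => Module.Finite R M ∧ Module.IsTorsionFree R M

variable (R) in
/-- The zero subcategory, consisting of the zero modules. -/
def zeroModules : ObjectProperty (ModuleCat.{u} R) :=
  fun M => Subsingleton M

end Subcategories

/-! The core is a trace argument. Let `M ≠ 0` be torsionfree in `X`. For finitely generated `N`, the
module Hom_R(N, M) is the kernel of a map between powers of `M`, so it lies in `X`. If `S` is finite
over `R`, then N = Hom_R(S, M) is a nonzero torsionfree `S`-module in `X`. Its `R`-endomorphisms are
`S`-linear and have traces in the normal ring `S`. Following the trace by the action S → End_R(N)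
gives an endomorphism of End_R(N) ∈ X whose image is isomorphic to the ideal `J` of traces. This
ideal is nonzero because it contains tr(id) = rank N, and the characteristic is zero. Hence S ≅
End_R(J) is in `X`, and each finitely generated torsionfree `S`-module is the image of some S^m →
S^n. For normal `R` one has S = R, which gives (2).

Most of the work is finiteness of `S` (`IsExcellentRing.finite_of_isIntegralClosure`). J-2 gives x ≠
0 such that R_p is regular, hence normal, whenever x ∉ p; so each b ∈ S satisfies x^N b ∈ R for some
N. To make N uniform, the G-ring condition yields reduced completions of the local rings, and a
Chevalley-type argument then puts the integral closure of some (x^n) inside (x). Superfluous factors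
of x can then be cancelled until x^n S ⊆ R. -/

/-! ### Lifting normality from the quotient by a prime element -/

section RegularLocal

open IsLocalRing Polynomial

/-- An element `c` that is integral over the principal ideal generated by `y` is a multiple of `y`
if the ring is integrally closed. -/
lemma dvd_of_isRoot_scaleRoots {D : Type*} [CommRing D] [IsDomain D] [IsIntegrallyClosed D]
    {f : D[X]} (hf : f.Monic) {y c : D} (h : (scaleRoots f y).IsRoot c) : y ∣ c := by
  rcases eq_or_ne y 0 with rfl | hy
  · rw [scaleRoots_zero, hf.leadingCoeff, one_smul, IsRoot.def, eval_pow, eval_X] at h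
    exact zero_dvd_iff.mpr (eq_zero_of_pow_eq_zero h)
  · let K := FractionRing D
    have hy' : algebraMap D K y ≠ 0 := by simpa using hy
    have hint : IsIntegral D (algebraMap D K c / algebraMap D K y) := by
      refine ⟨f, hf, ?_⟩
      have h1 : (scaleRoots f y).eval₂ (algebraMap D K)
          (algebraMap D K y * (algebraMap D K c / algebraMap D K y)) = 0 := by
        rw [mul_div_cancel₀ _ hy', eval₂_at_apply, h.eq_zero, map_zero]
      rw [scaleRoots_eval₂_mul] at h1
      exact (mul_eq_zero.mp h1).resolve_left (pow_ne_zero _ hy')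
    obtain ⟨d, hd⟩ := IsIntegrallyClosed.isIntegral_iff.mp hint
    refine ⟨d, IsFractionRing.injective D K ?_⟩
    rw [map_mul, hd, mul_div_cancel₀ _ hy']

/-- If `s * b = t` with `b` integral over `A` then `t` is integral over the ideal generated by
`s`. -/
lemma exists_monic_isRoot_scaleRoots {A K : Type*} [CommRing A] [CommRing K] [Algebra A K]
    (hinj : Function.Injective (algebraMap A K)) {b : K} (hb : IsIntegral A b) {s t : A}
    (h : algebraMap A K s * b = algebraMap A K t) :
    ∃ f : A[X], f.Monic ∧ (scaleRoots f s).IsRoot t := by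
  obtain ⟨f, hf, hfb⟩ := hb
  refine ⟨f, hf, hinj ?_⟩
  have := scaleRoots_eval₂_eq_zero (algebraMap A K) (s := s) hfb
  rwa [h, eval₂_at_apply, ← map_zero (algebraMap A K)] at this

/-- All lower coefficients of the equation are multiples of `s`, so modulo `p` it says that a power
of `t` vanishes. -/
lemma mem_of_isRoot_scaleRoots {A : Type*} [CommRing A] {f : A[X]} (hf : f.Monic) {s t : A}
    (h : (scaleRoots f s).IsRoot t) {p : Ideal A} [p.IsPrime] (hs : s ∈ p) : t ∈ p :=
  Ideal.IsPrime.mem_of_pow_mem ‹_› _ <|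
    (scaleRoots.isWeaklyEisensteinAt f hs).pow_natDegree_le_of_root_of_monic_mem h
      ((monic_scaleRoots_iff s).mpr hf) _ le_rfl

/-- The elements of `K` that map the ideal `p` of `A` to itself. -/
def idealStabilizer {A : Type*} (K : Type*) [CommRing A] [Field K] [Algebra A K] (p : Ideal A) :
    Submodule A K where
  carrier := {b | ∀ s ∈ p, ∃ t ∈ p, algebraMap A K s * b = algebraMap A K t}
  zero_mem' s _ := ⟨0, p.zero_mem, by simp⟩
  add_mem' {b c} hb hc s hs := by
    obtain ⟨t, ht, h⟩ := hb s hs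
    obtain ⟨t', ht', h'⟩ := hc s hs
    exact ⟨t + t', p.add_mem ht ht', by rw [mul_add, h, h', map_add]⟩
  smul_mem' a b hb s hs := by
    obtain ⟨t, ht, h⟩ := hb s hs
    exact ⟨a * t, p.mul_mem_left a ht, by
      rw [map_mul, ← h, Algebra.smul_def]; ring⟩

section Stabilizer

variable {A K : Type*} [CommRing A] [IsNoetherianRing A] [Field K] [Algebra A K]
  [IsFractionRing A K] {p : Ideal A}

/-- Determinant trick: `b` maps the nonzero finitely generated module `p` into itself. -/
lemma isIntegral_of_mem_idealStabilizer [IsDomain A] (hp : p ≠ ⊥) {b : K} (hb : b ∈ idealStabilizer K p) :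
    IsIntegral A b := by
  refine isIntegral_of_smul_mem_submodule (Submodule.map (Algebra.linearMap A K) p) ?_
    (Submodule.FG.map _ p.fg_of_isNoetherianRing) b ?_
  · obtain ⟨s, hs, hs0⟩ := p.ne_bot_iff.mp hp
    exact Submodule.ne_bot_iff _ |>.mpr ⟨_, ⟨s, hs, rfl⟩, by simpa using hs0⟩
  · rintro _ ⟨s, hs, rfl⟩
    obtain ⟨t, ht, h⟩ := hb s hs
    exact ⟨t, ht, by simp [← h, mul_comm]⟩

/-- Multiplication by a nonzero `s ∈ p` embeds the stabilizer into the noetherian module `A`. -/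
lemma fg_idealStabilizer (hp : p ≠ ⊥) : (idealStabilizer K p).FG := by
  obtain ⟨s, hs, hs0⟩ := p.ne_bot_iff.mp hp
  have hs0' : algebraMap A K s ≠ 0 := by simpa using hs0
  have hinj : Function.Injective (LinearMap.mulLeft A (algebraMap A K s)) := fun a b h ↦
    mul_left_cancel₀ hs0' h
  refine Submodule.fg_of_fg_map_injective _ hinj ?_
  have hle : (idealStabilizer K p).map (LinearMap.mulLeft A (algebraMap A K s)) ≤
      LinearMap.range (Algebra.linearMap A K) := by
    rintro _ ⟨b, hb, rfl⟩
    obtain ⟨t, -, h⟩ := hb s hs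
    exact ⟨t, by simp [h]⟩
  have : IsNoetherian A (LinearMap.range (Algebra.linearMap A K)) :=
    isNoetherian_of_surjective _ (LinearMap.range_rangeRestrict _)
  exact Submodule.FG.of_le (Module.Finite.iff_fg.mp inferInstance) hle

end Stabilizer

/-- A noetherian local domain is integrally closed if it is so modulo a prime element. -/
theorem isIntegrallyClosed_of_quotient_span_prime {A : Type*} (K : Type*) [CommRing A] [IsDomain A]
    [IsNoetherianRing A] [IsLocalRing A] [Field K] [Algebra A K] [IsFractionRing A K] {x : A} (hx : Prime x)
    (hA : IsIntegrallyClosed (A ⧸ Ideal.span {x})) : IsIntegrallyClosed A := by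
  have : (Ideal.span {x}).IsPrime := (Ideal.span_singleton_prime hx.ne_zero).mpr hx
  have hxm : x ∈ maximalIdeal A := hx.not_isUnit
  have hjac : Ideal.span {x} ≤ Ideal.jacobson ⊥ := by
    rw [IsLocalRing.jacobson_eq_maximalIdeal _ bot_ne_top, Ideal.span_singleton_le_iff_mem]
    exact hxm
  have hinj : Function.Injective (algebraMap A K) := IsFractionRing.injective A K
  have hx0 : algebraMap A K x ≠ 0 := by simpa using hx.ne_zero
  rw [isIntegrallyClosed_iff K]
  by_contra! hcon
  obtain ⟨b₀, hb₀, hb₀'⟩ := hcon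
  let D : K → Ideal A := fun b ↦ (LinearMap.range (Algebra.linearMap A K)).comap
    (LinearMap.toSpanSingleton A K b)
  have hD : ∀ a b, a ∈ D b ↔ ∃ r, algebraMap A K r = algebraMap A K a * b := by
    intro a b
    simp [D, Algebra.smul_def]
  -- Among the denominator ideals `D b` of integral `b ∉ A` a maximal one is prime, as for
  -- associated primes.
  obtain ⟨_, ⟨c, ⟨hc, hc'⟩, rfl⟩, hmax⟩ := set_has_maximal_iff_noetherian.mpr
    (inferInstanceAs (IsNoetherian A A)) (D '' {b | IsIntegral A b ∧ ∀ y, algebraMap A K y ≠ b})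
    ⟨_, b₀, ⟨hb₀, hb₀'⟩, rfl⟩
  set p := D c with hp
  have hp1 : (1 : A) ∉ p := by
    rw [hp, hD]
    rintro ⟨r, hr⟩
    exact hc' r (by simpa using hr)
  have : p.IsPrime := by
    refine ⟨fun h ↦ hp1 (h ▸ Submodule.mem_top), fun {a b} hab ↦ or_iff_not_imp_left.mpr fun ha ↦ ?_⟩
    have h1 : p ≤ D (algebraMap A K a * c) := by
      intro d hd
      rw [hp, hD] at hd
      obtain ⟨r, hr⟩ := hd
      rw [hD]
      exact ⟨a * r, by rw [map_mul, hr]; ring⟩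
    have h2 : ¬ p < D (algebraMap A K a * c) := hmax _ ⟨_, ⟨isIntegral_algebraMap.mul hc, fun y hy ↦
      ha (by rw [hp, hD]; exact ⟨y, hy⟩)⟩, rfl⟩
    rw [eq_of_le_of_not_lt h1 h2, hD]
    rw [hp, hD] at hab
    obtain ⟨r, hr⟩ := hab
    exact ⟨r, by rw [hr, map_mul]; ring⟩
  have hpbot : p ≠ ⊥ := by
    obtain ⟨u, v, hv, huv⟩ := IsFractionRing.div_surjective A c
    have hv0 : algebraMap A K v ≠ 0 := by simpa using nonZeroDivisors.ne_zero hv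
    refine p.ne_bot_iff.mpr ⟨v, ?_, nonZeroDivisors.ne_zero hv⟩
    rw [hp, hD]
    exact ⟨u, by rw [← huv, mul_div_cancel₀ _ hv0]⟩
  -- For `s ∈ p` the element `t = s c` of `A` is integral over `(s)`, so it lies in every prime
  -- containing `s`.
  have hcp : c ∈ idealStabilizer K p := by
    intro s hs
    have hs' := hs
    rw [hp, hD] at hs'
    obtain ⟨t, ht⟩ := hs'
    obtain ⟨f, hf, hfr⟩ := exists_monic_isRoot_scaleRoots hinj hc ht.symm
    exact ⟨t, mem_of_isRoot_scaleRoots hf hfr hs, ht.symm⟩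
  by_cases hxp : x ∈ p
  -- With `r = x c`, the square r² = x (r c) is divisible by the prime `x`, so `x ∣ r` and `c ∈ A`.
  · obtain ⟨r, hr, hxr⟩ := hcp x hxp
    obtain ⟨t, -, hrt⟩ := hcp r hr
    have h1 : r * r = x * t := hinj (by
      rw [map_mul, map_mul, ← hrt, ← hxr]; ring)
    obtain ⟨w, rfl⟩ := (or_self_iff.mp (hx.dvd_or_dvd ⟨t, h1⟩) : x ∣ r)
    refine hc' w (mul_left_cancel₀ hx0 ?_)
    rw [hxr, map_mul]
  -- Otherwise p = x p, and Nakayama gives p = 0.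
  · obtain ⟨s, hs, hxs⟩ : ∃ s ∈ p, ¬ x ∣ s := by
      by_contra! hcon
      refine hpbot (Submodule.eq_bot_of_le_smul_of_le_jacobson_bot (Ideal.span {x}) p
        p.fg_of_isNoetherianRing (fun s hs ↦ ?_) hjac)
      obtain ⟨s', rfl⟩ := hcon s hs
      exact Submodule.smul_mem_smul (Ideal.mem_span_singleton_self x)
        ((Ideal.IsPrime.mem_or_mem ‹_› hs).resolve_left hxp)
    -- For `b` in the stabilizer B, normality of A/(x) gives `w` with x ∣ s (b - w). Then (b - w)/x
    -- again stabilizes `p`, because `x` is prime, x ∤ s and x ∉ p. So B ⊆ A + x B, and Nakayama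
    -- yields B ⊆ A.
    have hle : idealStabilizer K p ≤ LinearMap.range (Algebra.linearMap A K) ⊔
        Ideal.span {x} • idealStabilizer K p := by
      intro b hb
      obtain ⟨t, ht, hst⟩ := hb s hs
      obtain ⟨f, hf, hfr⟩ := exists_monic_isRoot_scaleRoots hinj
        (isIntegral_of_mem_idealStabilizer hpbot hb) hst
      let π := Ideal.Quotient.mk (Ideal.span {x})
      have hroot : (scaleRoots (f.map π) (π s)).IsRoot (π t) := by
        rw [← map_scaleRoots _ _ _ (by rw [hf.leadingCoeff, map_one]; exact one_ne_zero)]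
        exact hfr.map
      obtain ⟨w, hw⟩ := dvd_of_isRoot_scaleRoots (hf.map π) hroot
      obtain ⟨w, rfl⟩ := Ideal.Quotient.mk_surjective w
      rw [← map_mul, Ideal.Quotient.eq, Ideal.mem_span_singleton] at hw
      obtain ⟨r, hr⟩ := hw
      have hsd : algebraMap A K s * (b - algebraMap A K w) =
          algebraMap A K x * algebraMap A K r := by
        rw [mul_sub, hst, ← map_mul, ← map_mul, ← map_sub, hr]
      have hd : (b - algebraMap A K w) / algebraMap A K x ∈ idealStabilizer K p := by
        intro s' hs'
        obtain ⟨t', ht', h'⟩ := hb s' hs'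
        have h1 : s * (t' - s' * w) = x * (s' * r) := hinj (by
          rw [map_mul, map_sub, ← h', map_mul, map_mul, map_mul]
          linear_combination (algebraMap A K s') * hsd)
        obtain ⟨y, hy⟩ := (hx.dvd_or_dvd ⟨_, h1⟩).resolve_left hxs
        have hyp : x * y ∈ p := hy ▸ p.sub_mem ht' (p.mul_mem_right _ hs')
        refine ⟨y, (Ideal.IsPrime.mem_or_mem ‹_› hyp).resolve_left hxp, mul_left_cancel₀ hx0 ?_⟩
        rw [← map_mul, ← hy, map_sub, ← h', map_mul]
        field_simp
      refine Submodule.mem_sup.mpr ⟨_, ⟨w, rfl⟩, _,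
        Submodule.smul_mem_smul (Ideal.mem_span_singleton_self x) hd, ?_⟩
      rw [Algebra.smul_def, mul_div_cancel₀ _ hx0]
      simp
    obtain ⟨y, hy⟩ := Submodule.le_of_le_smul_of_le_jacobson_bot (fg_idealStabilizer hpbot) hjac
      hle hcp
    exact hc' y hy

end RegularLocal

/-! ### Regular local rings are normal domains -/

section RegularLocalDomain

open IsLocalRing

/-- Since x ∉ m², some member of a minimal generating set has a unit coefficient in an expression of
`x`; it becomes redundant modulo `x`. -/
lemma spanFinrank_maximalIdeal_quotient_lt {A : Type*} [CommRing A] [IsLocalRing A]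
    [IsNoetherianRing A] {x : A} (hx : x ∈ maximalIdeal A) (hx2 : x ∉ maximalIdeal A ^ 2)
    [IsLocalRing (A ⧸ Ideal.span {x})] :
    (maximalIdeal (A ⧸ Ideal.span {x})).spanFinrank < (maximalIdeal A).spanFinrank := by
  classical
  obtain ⟨t, ht, hspan⟩ := Submodule.FG.exists_span_finset_card_eq_spanFinrank
    (maximalIdeal A).fg_of_isNoetherianRing
  have hxt : x ∈ Submodule.span A (t : Set A) := hspan ▸ hx
  obtain ⟨a, -, ha⟩ := Submodule.mem_span_finset.mp hxt
  have htm : ∀ y ∈ t, y ∈ maximalIdeal A := fun y hy ↦ hspan ▸ Submodule.subset_span hy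
  obtain ⟨y, hy, hay⟩ : ∃ y ∈ t, IsUnit (a y) := by
    by_contra! hcon
    refine hx2 (ha ▸ Ideal.sum_mem _ fun y hy ↦ ?_)
    rw [pow_two, smul_eq_mul]
    exact Ideal.mul_mem_mul (hcon y hy) (htm y hy)
  let π := Ideal.Quotient.mk (Ideal.span {x})
  have hle : maximalIdeal (A ⧸ Ideal.span {x}) ≤ Ideal.span (π '' (t.erase y : Finset A)) := by
    have hmem : ∀ w ∈ t.erase y, π w ∈ Ideal.span (π '' (t.erase y : Finset A)) := fun w hw ↦
      Ideal.subset_span ⟨w, hw, rfl⟩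
    have hymem : π y ∈ Ideal.span (π '' (t.erase y : Finset A)) := by
      rw [← Finset.add_sum_erase _ _ hy] at ha
      have h0 : π x = 0 := Ideal.Quotient.eq_zero_iff_mem.mpr (Ideal.mem_span_singleton_self x)
      rw [congrArg π ha.symm, map_add, smul_eq_mul, map_mul, add_eq_zero_iff_eq_neg] at h0
      rw [← Ideal.unit_mul_mem_iff_mem _ (hay.map π), h0, map_sum]
      refine neg_mem (Ideal.sum_mem _ fun w hw ↦ ?_)
      rw [smul_eq_mul, map_mul]
      exact Ideal.mul_mem_left _ _ (hmem w hw)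
    have hmap : maximalIdeal (A ⧸ Ideal.span {x}) ≤ (maximalIdeal A).map π := by
      intro z hz
      obtain ⟨z, rfl⟩ := Ideal.Quotient.mk_surjective z
      exact Ideal.mem_map_of_mem π fun hu ↦ hz (hu.map π)
    refine hmap.trans (Ideal.map_le_iff_le_comap.mpr ?_)
    rw [← hspan, Submodule.span_le]
    intro w hw
    rcases eq_or_ne w y with rfl | hne
    · exact hymem
    · exact hmem w (Finset.mem_erase.mpr ⟨hne, hw⟩)
  have hge : Ideal.span (π '' (t.erase y : Finset A)) ≤ maximalIdeal (A ⧸ Ideal.span {x}) := by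
    rw [Ideal.span_le]
    rintro _ ⟨w, hw, rfl⟩
    intro hu
    obtain ⟨v, hv⟩ := hu.exists_right_inv
    obtain ⟨v, rfl⟩ := Ideal.Quotient.mk_surjective v
    rw [← map_mul, ← map_one π, Ideal.Quotient.eq] at hv
    have h1 := (Ideal.span_singleton_le_iff_mem _).mpr hx hv
    have h2 : w * v ∈ maximalIdeal A :=
      Ideal.mul_mem_right _ _ (htm w (Finset.mem_of_mem_erase hw))
    exact (Ideal.ne_top_iff_one _).mp (maximalIdeal.isMaximal A).ne_top
      (by simpa using sub_mem h2 h1)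
  rw [le_antisymm hle hge]
  refine lt_of_le_of_lt
    (Submodule.spanFinrank_span_le_ncard_of_finite ((Finset.finite_toSet _).image _)) ?_
  refine lt_of_le_of_lt (Set.ncard_image_le (Finset.finite_toSet _)) ?_
  rw [Set.ncard_coe_finset, ← ht]
  exact Finset.card_erase_lt_of_mem hy

/-- A regular local ring is an integrally closed domain. -/
theorem isDomain_and_isIntegrallyClosed_of_isRegularLocalRing (A : Type u) [CommRing A]
    [IsRegularLocalRing A] : IsDomain A ∧ IsIntegrallyClosed A := by
  induction hn : (maximalIdeal A).spanFinrank using Nat.strong_induction_on generalizing A with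
  | _ n ih =>
  by_cases hm : maximalIdeal A = ⊥
  · have hf := isField_iff_maximalIdeal_eq.mpr hm
    let := hf.toField
    exact ⟨inferInstance, inferInstance⟩
  have hdim : ((maximalIdeal A).height : WithBot ℕ∞) = n := by
    rw [maximalIdeal_height_eq_ringKrullDim, ← IsRegularLocalRing.spanFinrank_maximalIdeal, hn]
  have hn0 : n ≠ 0 := by
    rintro rfl
    exact hm ((Submodule.spanFinrank_eq_zero_iff_eq_bot
      (maximalIdeal A).fg_of_isNoetherianRing).mp hn)
  obtain ⟨x, hx, hx2, hxq⟩ : ∃ x ∈ maximalIdeal A, x ∉ maximalIdeal A ^ 2 ∧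
      ∀ q ∈ minimalPrimes A, x ∉ q := by
    -- Prime avoidance, where `maximalIdeal A ^ 2` is the one member of the family allowed not to be
    -- prime.
    have h := (Ideal.subset_union_prime_finite (s := insert (maximalIdeal A ^ 2) (minimalPrimes A))
      ((minimalPrimes.finite_of_isNoetherianRing A).insert _) (f := id) (I := maximalIdeal A)
      (maximalIdeal A ^ 2) (maximalIdeal A ^ 2) (by
        intro q hq hne _
        exact (hq.resolve_left hne).1.1)).not
    simp only [Set.not_subset, Set.mem_iUnion, not_exists] at h
    obtain ⟨x, hx, hx'⟩ := h.mpr (by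
      rintro q ⟨rfl | hq, hle⟩
      · refine hm (Submodule.eq_bot_of_le_smul_of_le_jacobson_bot (maximalIdeal A) _
          (maximalIdeal A).fg_of_isNoetherianRing (by simpa [pow_two] using hle) ?_)
        rw [IsLocalRing.jacobson_eq_maximalIdeal _ bot_ne_top]
      · have := hq.1.1
        have hqe : q = maximalIdeal A := le_antisymm (le_maximalIdeal this.ne_top) hle
        rw [← hqe, Ideal.height_eq_zero_iff.mpr hq] at hdim
        exact hn0 (by exact_mod_cast hdim.symm))
    exact ⟨x, hx, fun h ↦ hx' _ (Set.mem_insert _ _) h,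
      fun q hq h ↦ hx' q (Set.mem_insert_of_mem _ hq) h⟩
  have hxne : Ideal.span {x} ≠ ⊤ := by
    rw [Ne, Ideal.span_singleton_eq_top]
    exact hx
  have hjac : Ideal.span {x} ≤ Ideal.jacobson ⊥ := by
    rw [IsLocalRing.jacobson_eq_maximalIdeal _ bot_ne_top, Ideal.span_singleton_le_iff_mem]
    exact hx
  have : Nontrivial (A ⧸ Ideal.span {x}) := Ideal.Quotient.nontrivial_iff.mpr hxne
  have : IsLocalRing (A ⧸ Ideal.span {x}) :=
    IsLocalRing.of_surjective' (Ideal.Quotient.mk _) Ideal.Quotient.mk_surjective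
  have hlt := spanFinrank_maximalIdeal_quotient_lt hx hx2
  -- The embedding dimension drops by at least one, the Krull dimension by at most one.
  have hreg : IsRegularLocalRing (A ⧸ Ideal.span {x}) := by
    refine IsRegularLocalRing.of_spanFinrank_maximalIdeal_le _ ?_
    have h1 := Ideal.height_le_ringKrullDim_quotient_add_one hx
    rw [hdim] at h1
    have h2 : (((maximalIdeal (A ⧸ Ideal.span {x})).spanFinrank + 1 : ℕ) : WithBot ℕ∞) ≤
        ringKrullDim (A ⧸ Ideal.span {x}) + 1 := le_trans (by rw [hn] at hlt; exact_mod_cast hlt) h1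
    generalize ringKrullDim (A ⧸ Ideal.span {x}) = d at h2
    induction d with
    | bot => simp at h2
    | coe d =>
      induction d with
      | top => exact_mod_cast le_top
      | coe d =>
        norm_cast at h2 ⊢
        omega
  obtain ⟨hdom, hint⟩ := ih _ (hn ▸ hlt) (A ⧸ Ideal.span {x}) rfl
  have hprime : (Ideal.span {x}).IsPrime := (Ideal.Quotient.isDomain_iff_prime _).mp hdom
  have hAdom : IsDomain A := by
    -- A minimal prime q ⊆ (x) does not contain `x`, so q = x q and Nakayama gives q = 0.
    obtain ⟨q, hq, hqx⟩ := Ideal.exists_minimalPrimes_le (bot_le : ⊥ ≤ Ideal.span {x})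
    have := hq.1.1
    have hq0 : q = ⊥ := by
      refine Submodule.eq_bot_of_le_smul_of_le_jacobson_bot (Ideal.span {x}) q
        q.fg_of_isNoetherianRing (fun s hs ↦ ?_) hjac
      obtain ⟨s', rfl⟩ := Ideal.mem_span_singleton.mp (hqx hs)
      exact Submodule.smul_mem_smul (Ideal.mem_span_singleton_self x)
        ((Ideal.IsPrime.mem_or_mem ‹_› hs).resolve_left (hxq q hq))
    exact IsDomain.of_bot_isPrime A (hbp := hq0 ▸ this)
  have hx0 : x ≠ 0 := fun h ↦ hx2 (h ▸ zero_mem _)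
  exact ⟨hAdom, isIntegrallyClosed_of_quotient_span_prime (FractionRing A)
    ((Ideal.span_singleton_prime hx0).mp hprime) hint⟩

end RegularLocalDomain

/-! ### Completions of noetherian rings -/

section Completion

open IsLocalRing

/-- The completion of a noetherian ring with respect to an ideal is noetherian. -/
theorem isNoetherianRing_adicCompletion {A : Type*} [CommRing A] [IsNoetherianRing A]
    (I : Ideal A) : IsNoetherianRing (AdicCompletion I A) := by
  obtain ⟨t, ht⟩ := I.fg_of_isNoetherianRing
  -- The completion is a quotient of the completed polynomial ring on generators of `I`, which is a
  -- power series ring.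
  let f : MvPolynomial t A →+* A := (MvPolynomial.aeval (Subtype.val : t → A)).toRingHom
  have hfC : ∀ a, f (MvPolynomial.C a) = a := fun a ↦ by simp [f]
  let J := MvPolynomial.idealOfVars t A
  have hJ : J.map f = I := by
    rw [show J = Ideal.span (Set.range MvPolynomial.X) from rfl, Ideal.map_span, ← ht, ← Set.range_comp]
    congr 1
    ext a
    simp [f]
  have : IsNoetherianRing (AdicCompletion J (MvPolynomial t A)) :=
    isNoetherianRing_of_ringEquiv _ (MvPowerSeries.toAdicCompletionAlgEquiv t A).toRingEquiv
  have hpow : ∀ k, J ^ k ≤ (I ^ k).comap f := fun k ↦ by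
    rw [← Ideal.map_le_iff_le_comap, Ideal.map_pow, hJ]
  let g : ∀ k, AdicCompletion J (MvPolynomial t A) →+* A ⧸ I ^ k := fun k ↦
    (Ideal.quotientMap (I ^ k) f (hpow k)).comp
      (AdicCompletion.evalₐ J k : AdicCompletion J (MvPolynomial t A) →+* _)
  have hg : ∀ {m n : ℕ} (hle : m ≤ n), (Ideal.Quotient.factorPow I hle).comp (g n) = g m := by
    intro m n hle
    ext x
    obtain ⟨x, rfl⟩ := AdicCompletion.mk_surjective J _ x
    simp only [g, RingHom.comp_apply, RingHom.coe_coe, AdicCompletion.evalₐ_mk,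
      Ideal.quotientMap_mk]
    have h := congrArg (Ideal.quotientMap (I ^ m) f (hpow m))
      (AdicCompletion.Ideal.mk_eq_mk (I := J) hle x)
    rw [Ideal.quotientMap_mk, Ideal.quotientMap_mk] at h
    exact h
  let φ := AdicCompletion.liftRingHom I g hg
  have hφ : φ.comp (algebraMap (MvPolynomial t A) _) = (algebraMap A (AdicCompletion I A)).comp f := by
    refine RingHom.ext fun p ↦ AdicCompletion.ext_evalₐ fun n ↦ ?_
    simp [φ, g, AdicCompletion.algebraMap_apply]
  have := AdicCompletion.isAdicComplete_self J (MvPolynomial.idealOfVars_fg t A)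
  have := AdicCompletion.isAdicComplete_self I I.fg_of_isNoetherianRing
  have hmap : (J.map (algebraMap _ (AdicCompletion J (MvPolynomial t A)))).map φ =
      I.map (algebraMap A (AdicCompletion I A)) := by
    rw [Ideal.map_map, hφ, ← Ideal.map_map, hJ]
  have hsurj : Function.Surjective φ := by
    have : IsHausdorff ((J.map (algebraMap _ (AdicCompletion J (MvPolynomial t A)))).map φ)
      (AdicCompletion I A) := by rw [hmap]; infer_instance
    -- By completeness, surjectivity may be checked modulo the ideal of the variables, where
    -- constants suffice.
    refine surjective_of_mk_map_comp_surjective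
      (I := J.map (algebraMap _ (AdicCompletion J (MvPolynomial t A)))) φ fun y ↦ ?_
    obtain ⟨y, rfl⟩ := Ideal.Quotient.mk_surjective y
    obtain ⟨a, ha⟩ := Ideal.Quotient.mk_surjective (AdicCompletion.evalOneₐ I y)
    refine ⟨algebraMap _ _ (MvPolynomial.C a : MvPolynomial t A), ?_⟩
    rw [RingHom.comp_apply, Ideal.Quotient.eq, hmap, ← RingHom.comp_apply φ, hφ,
      RingHom.comp_apply, hfC, ← AdicCompletion.ker_evalOneₐ_eq_map I I.fg_of_isNoetherianRing,
      RingHom.mem_ker, map_sub, sub_eq_zero]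
    exact ha
  exact isNoetherianRing_of_surjective _ _ φ hsurj

end Completion

/-! ### Reducedness along regular homomorphisms -/

section Regular

lemma isReduced_of_isRegularRing (B : Type u) [CommRing B] [IsRegularRing B] : IsReduced B := by
  refine isReduced_ofLocalizationMaximal B fun m hm ↦ ?_
  have := (isDomain_and_isIntegrallyClosed_of_isRegularLocalRing (Localization.AtPrime m)).1
  infer_instance

/-- If a domain has a regular homomorphism to `B`, then `B` is reduced. -/
lemma IsRegularHom.isReduced {A B : Type u} [CommRing A] [IsDomain A] [CommRing B] [Algebra A B]
    (h : IsRegularHom A B) : IsReduced B := by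
  obtain ⟨hflat, hfib⟩ := h
  let κ := (⊥ : Ideal A).ResidueField
  -- The generic fibre, with the trivial extension of κ; by flatness `B` embeds into it.
  have hreg : IsRegularRing (κ ⊗[κ] (κ ⊗[A] B)) := hfib ⊥ κ inferInstance
  have := isReduced_of_isRegularRing (κ ⊗[κ] (κ ⊗[A] B))
  have hinj : Function.Injective (algebraMap A κ) := by
    rw [RingHom.injective_iff_ker_eq_bot, Ideal.ker_algebraMap_residueField]
  refine isReduced_of_injective ((Algebra.TensorProduct.includeRight : κ ⊗[A] B →ₐ[κ] κ ⊗[κ] (κ ⊗[A] B)).toRingHom.comp (Algebra.TensorProduct.includeRight : B →ₐ[A] κ ⊗[A] B).toRingHom) ?_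
  refine Function.Injective.comp (g := Algebra.TensorProduct.includeRight) ?_ ?_
  · exact Algebra.TensorProduct.includeRight_injective (RingHom.injective _)
  · exact Algebra.TensorProduct.includeRight_injective hinj

end Regular

/-! ### Integral closures of principal ideals -/

section IntegralOverSpan

open Polynomial

/-- `c` is integral over the principal ideal generated by `y`. -/
def IsIntegralOverSpan {A : Type*} [CommRing A] (y c : A) : Prop :=
  ∃ f : A[X], f.Monic ∧ (scaleRoots f y).IsRoot c

lemma IsIntegralOverSpan.map {A B : Type*} [CommRing A] [CommRing B] [Nontrivial B] {y c : A}
    (h : IsIntegralOverSpan y c) (φ : A →+* B) : IsIntegralOverSpan (φ y) (φ c) := by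
  obtain ⟨f, hf, hc⟩ := h
  refine ⟨f.map φ, hf.map φ, ?_⟩
  rw [← map_scaleRoots _ _ _ (by rw [hf.leadingCoeff, map_one]; exact one_ne_zero)]
  exact hc.map

section Domain

variable {A : Type*} (K : Type*) [CommRing A] [Field K] [Algebra A K]
  [IsFractionRing A K]

lemma isIntegralOverSpan_iff {y : A} (hy : y ≠ 0) (c : A) :
    IsIntegralOverSpan y c ↔ IsIntegral A (algebraMap A K c / algebraMap A K y) := by
  have hy' : algebraMap A K y ≠ 0 := by simpa using hy
  refine ⟨fun ⟨f, hf, h⟩ ↦ ⟨f, hf, ?_⟩, fun h ↦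
    exists_monic_isRoot_scaleRoots (IsFractionRing.injective A K) h (mul_div_cancel₀ _ hy')⟩
  have h1 : (scaleRoots f y).eval₂ (algebraMap A K)
      (algebraMap A K y * (algebraMap A K c / algebraMap A K y)) = 0 := by
    rw [mul_div_cancel₀ _ hy', eval₂_at_apply, h.eq_zero, map_zero]
  rw [scaleRoots_eval₂_mul] at h1
  exact (mul_eq_zero.mp h1).resolve_left (pow_ne_zero _ hy')

end Domain

variable {A : Type*} [CommRing A] [IsDomain A]

/-- The integral closure of the ideal generated by `y ≠ 0` in a domain. -/
def spanIntegralClosure (y : A) (hy : y ≠ 0) : Ideal A where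
  carrier := {c | IsIntegralOverSpan y c}
  zero_mem' := (isIntegralOverSpan_iff (FractionRing A) hy 0).mpr (by
    simpa using isIntegral_zero)
  add_mem' {a b} ha hb := by
    rw [Set.mem_ofPred, isIntegralOverSpan_iff (FractionRing A) hy] at *
    rw [map_add, add_div]
    exact ha.add hb
  smul_mem' r a ha := by
    rw [Set.mem_ofPred, isIntegralOverSpan_iff (FractionRing A) hy] at *
    rw [smul_eq_mul, map_mul, mul_div_assoc]
    exact isIntegral_algebraMap.mul ha

lemma mem_spanIntegralClosure {y : A} {hy : y ≠ 0} {c : A} :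
    c ∈ spanIntegralClosure y hy ↔ IsIntegralOverSpan y c := Iff.rfl

lemma spanIntegralClosure_pow_antitone {x : A} (hx : x ≠ 0) :
    Antitone fun n : ℕ ↦ spanIntegralClosure (x ^ n) (pow_ne_zero n hx) := by
  refine antitone_nat_of_succ_le fun n a ha ↦ ?_
  rw [mem_spanIntegralClosure, isIntegralOverSpan_iff (FractionRing A) (pow_ne_zero _ hx)] at *
  have hx' : algebraMap A (FractionRing A) x ≠ 0 := by simpa using hx
  have : algebraMap A (FractionRing A) a / algebraMap A (FractionRing A) (x ^ n) =
      algebraMap A (FractionRing A) x *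
        (algebraMap A (FractionRing A) a / algebraMap A (FractionRing A) (x ^ (n + 1))) := by
    rw [map_pow, map_pow, pow_succ]
    field_simp
  rw [this]
  exact isIntegral_algebraMap.mul ha

/-- In a noetherian domain, no nonzero element is integral over all powers of a proper principal
ideal. -/
lemma exists_not_isIntegralOverSpan_pow [IsNoetherianRing A] {x c : A} (hx : x ≠ 0)
    (hxu : ¬ IsUnit x) (hc : c ≠ 0) : ∃ n : ℕ, ¬ IsIntegralOverSpan (x ^ n) c := by
  obtain ⟨q, hq⟩ := Ideal.nonempty_minimalPrimes
    (show Ideal.span {x} ≠ ⊤ by rwa [Ne, Ideal.span_singleton_eq_top])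
  have hqp : q.IsPrime := hq.1.1
  have hxq : x ∈ q := hq.1.2 (Ideal.mem_span_singleton_self x)
  have hht : q.height ≤ 1 := Ideal.height_le_one_of_isPrincipal_of_mem_minimalPrimes _ q hq
  -- The localization at `q` has dimension at most one, so inverting `x` as well leaves only the
  -- zero prime and `c` becomes a unit.
  obtain ⟨s, hs, N, d, hd⟩ : ∃ s ∉ q, ∃ N : ℕ, ∃ d, s * x ^ N = c * d := by
    by_contra! hcon
    have hdisj : Disjoint (Ideal.span {c} : Set A)
        ((q.primeCompl ⊔ Submonoid.powers x : Submonoid A) : Set A) := by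
      rw [Set.disjoint_left]
      intro y hy hy'
      obtain ⟨s, hs, _, ⟨N, rfl⟩, rfl⟩ := Submonoid.mem_sup.mp hy'
      obtain ⟨d, hd⟩ := Ideal.mem_span_singleton.mp hy
      exact hcon s hs N d hd
    obtain ⟨p, hp, hcp, hpd⟩ := Ideal.exists_le_prime_disjoint _ _ hdisj
    have hpq : p < q := by
      refine lt_of_le_of_ne (fun y hy ↦ ?_) ?_
      · by_contra hyq
        exact Set.disjoint_left.mp hpd hy ((le_sup_left : q.primeCompl ≤ _) hyq)
      · rintro rfl
        exact Set.disjoint_left.mp hpd hxq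
          ((le_sup_right : Submonoid.powers x ≤ _) (Submonoid.mem_powers x))
    have h1 := (Ideal.height_add_one_le_of_lt_of_isPrime hpq).trans hht
    have h2 : p.height = 0 := by
      generalize p.height = h at h1
      induction h with
      | top => simp at h1
      | coe h =>
        norm_cast at h1 ⊢
        omega
    rw [Ideal.height_eq_zero_iff_eq_bot] at h2
    exact hc (by simpa [h2] using hcp)
  -- If `c` were integral over (x^(N+1)), then d c / x^(N+1) = s / x would be integral, forcing s ∈
  -- q.
  refine ⟨N + 1, fun hint ↦ hs ?_⟩
  rw [isIntegralOverSpan_iff (FractionRing A) (pow_ne_zero _ hx)] at hint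
  have hx' : algebraMap A (FractionRing A) x ≠ 0 := by simpa using hx
  have hd' := congrArg (algebraMap A (FractionRing A)) hd
  obtain ⟨f, hf, hfr⟩ := exists_monic_isRoot_scaleRoots (IsFractionRing.injective A (FractionRing A))
    ((isIntegral_algebraMap (x := d)).mul hint) (s := x) (t := s) (by
      simp only [map_mul, map_pow] at hd' ⊢
      field_simp
      rw [pow_succ]
      linear_combination - hd' * algebraMap A (FractionRing A) x)
  exact mem_of_isRoot_scaleRoots hf hfr hxq

end IntegralOverSpan

/-! ### A Chevalley-type argument in the completion -/

section Chevalley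

open IsLocalRing

lemma map_mem_maximalIdeal_of_surjective {A B : Type*} [CommRing A] [CommRing B] [IsLocalRing A]
    [IsLocalRing B] {f : A →+* B} (hf : Function.Surjective f) :
    (maximalIdeal A).map f ≤ maximalIdeal B := by
  have := IsLocalHom.of_surjective f hf
  exact ((local_hom_TFAE f).out 0 2).mp this

variable {A : Type*} [CommRing A] [IsNoetherianRing A] [IsLocalRing A]

lemma isArtinianRing_quotient_maximalIdeal_pow (j : ℕ) :
    IsArtinianRing (A ⧸ maximalIdeal A ^ (j + 1)) := by
  have hne : maximalIdeal A ^ (j + 1) ≠ ⊤ :=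
    ne_top_of_le_ne_top (maximalIdeal.isMaximal A).ne_top (Ideal.pow_le_self j.succ_ne_zero)
  have := Ideal.Quotient.nontrivial_iff.mpr hne
  have hs := Ideal.Quotient.mk_surjective (I := maximalIdeal A ^ (j + 1))
  have : IsLocalRing (A ⧸ maximalIdeal A ^ (j + 1)) := .of_surjective' _ hs
  rw [isArtinianRing_iff_isNilpotent_maximalIdeal]
  refine ⟨j + 1, ?_⟩
  have hle : maximalIdeal (A ⧸ maximalIdeal A ^ (j + 1)) ≤
      (maximalIdeal A).map (Ideal.Quotient.mk (maximalIdeal A ^ (j + 1))) := by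
    intro z hz
    obtain ⟨z, rfl⟩ := hs z
    exact Ideal.mem_map_of_mem _ fun hu ↦ hz (hu.map _)
  refine le_bot_iff.mp ((Ideal.pow_right_mono hle _).trans ?_)
  rw [← Ideal.map_pow, Ideal.map_quotient_self]

/-- The quotient by a power of the maximal ideal is artinian, so the images of the `T n` stabilize.
-/
lemma exists_forall_sup_maximalIdeal_pow_eq {T : ℕ → Ideal A} (hT : Antitone T) (j : ℕ) :
    ∃ N, ∀ n, N ≤ n → T n ⊔ maximalIdeal A ^ j = T N ⊔ maximalIdeal A ^ j := by
  cases j with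
  | zero => exact ⟨0, fun n _ ↦ by simp⟩
  | succ j =>
    have := isArtinianRing_quotient_maximalIdeal_pow (A := A) j
    let π := Ideal.Quotient.mk (maximalIdeal A ^ (j + 1))
    obtain ⟨N, hN⟩ := IsArtinian.monotone_stabilizes (R := A ⧸ maximalIdeal A ^ (j + 1))
      (M := A ⧸ maximalIdeal A ^ (j + 1))
      ⟨fun n ↦ OrderDual.toDual ((T n).map π), fun m n h ↦ Ideal.map_mono (hT h)⟩
    refine ⟨N, fun n hn ↦ ?_⟩
    have h : (T N).map π = (T n).map π := hN n hn
    have h' := congrArg (Ideal.comap π) h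
    rw [Ideal.comap_map_of_surjective' _ Ideal.Quotient.mk_surjective,
      Ideal.comap_map_of_surjective' _ Ideal.Quotient.mk_surjective, Ideal.mk_ker] at h'
    exact h'.symm

/-- If none of the ideals in a decreasing sequence is contained in the `k`-th power of the maximal
ideal, then some element of the completion outside the `k`-th power is a limit of elements of each
of these ideals. -/
lemma exists_adicCompletion_mem_closure {T : ℕ → Ideal A} (hT : Antitone T) {k : ℕ}
    (hk : ∀ n, ¬ T n ≤ maximalIdeal A ^ k) :
    ∃ c : AdicCompletion (maximalIdeal A) A, c ≠ 0 ∧ ∀ n i : ℕ, ∃ a ∈ T n,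
      c - algebraMap A _ a ∈
        (maximalIdeal (AdicCompletion (maximalIdeal A) A)) ^ i := by
  choose N hN using exists_forall_sup_maximalIdeal_pow_eq hT
  -- `E j` is the stable value of T n + m^j. Its elements lift to `E (j + 1)` up to m^j, which
  -- produces Cauchy sequences.
  let E : ℕ → Ideal A := fun j ↦ T (N j) ⊔ maximalIdeal A ^ j
  have hE : ∀ j n, E j ≤ T n ⊔ maximalIdeal A ^ j := fun j n ↦ by
    rw [show E j = T (max n (N j)) ⊔ maximalIdeal A ^ j from (hN j _ (le_max_right _ _)).symm]
    exact sup_le_sup_right (hT (le_max_left _ _)) _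
  have hstep : ∀ j, E j ≤ E (j + 1) ⊔ maximalIdeal A ^ j := fun j ↦
    (hE j (N (j + 1))).trans (sup_le_sup_right le_sup_left _)
  have hstep' : ∀ j (a : E j), ∃ b : E (j + 1), (b - a : A) ∈ maximalIdeal A ^ j := by
    rintro j ⟨a, ha⟩
    obtain ⟨b, hb, e, he, rfl⟩ := Submodule.mem_sup.mp (hstep j ha)
    exact ⟨⟨b, hb⟩, by simpa using he⟩
  choose g hg using hstep'
  obtain ⟨a₀, ha₀, ha₀'⟩ := SetLike.not_le_iff_exists.mp (hk (N k))
  -- The sequence starts at level `k` outside m^k and afterwards changes only by elements of m^k, so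
  -- its limit is nonzero.
  let s : ∀ i, E (k + i) := fun i ↦ Nat.rec (motive := fun i ↦ E (k + i)) ⟨a₀, Submodule.mem_sup_left ha₀⟩ (fun i a ↦ g _ a) i
  have hs0 : (s 0 : A) = a₀ := rfl
  have hs : ∀ i, (s (i + 1) - s i : A) ∈ maximalIdeal A ^ (k + i) := fun i ↦ hg _ (s i)
  let f : AdicCompletion.AdicCauchySequence (maximalIdeal A) A :=
    AdicCompletion.AdicCauchySequence.mk _ _ (fun i ↦ (s i : A)) fun n ↦ by
      rw [SModEq.comm, SModEq.sub_mem, smul_eq_mul, Ideal.mul_top]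
      exact Ideal.pow_le_pow_right (Nat.le_add_left _ _) (hs n)
  have hsk : ∀ i, (s i - a₀ : A) ∈ maximalIdeal A ^ k := by
    intro i
    induction i with
    | zero => simp [hs0]
    | succ i ih =>
      have := add_mem (Ideal.pow_le_pow_right (Nat.le_add_right _ _) (hs i)) ih
      simpa using this
  refine ⟨AdicCompletion.mk _ _ f, fun h ↦ ?_, fun n i ↦ ?_⟩
  · have h1 := congrArg (AdicCompletion.evalₐ (maximalIdeal A) k) h
    rw [AdicCompletion.evalₐ_mk, map_zero, Ideal.Quotient.eq_zero_iff_mem] at h1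
    have h2 := sub_mem h1 (hsk k)
    exact ha₀' (by simpa [f] using h2)
  · obtain ⟨t, ht, e, he, hte⟩ := Submodule.mem_sup.mp (hE (k + i) n (s i).2)
    refine ⟨t, ht, ?_⟩
    have hmap : ∀ j, maximalIdeal (AdicCompletion (maximalIdeal A) A) ^ j =
        (maximalIdeal A ^ j).map (algebraMap A _) := fun j ↦ by
      rw [AdicCompletion.maximalIdeal_eq_map, Ideal.map_pow]
    have h1 : AdicCompletion.mk _ _ f - algebraMap A _ (s i : A) ∈
        maximalIdeal (AdicCompletion (maximalIdeal A) A) ^ i := by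
      rw [hmap, ← Submodule.restrictScalars_mem A, ← Ideal.smul_top_eq_map,
        AdicCompletion.pow_smul_top_eq_ker_eval (maximalIdeal A).fg_of_isNoetherianRing]
      rw [LinearMap.mem_ker, map_sub, sub_eq_zero]
      rfl
    have h2 : algebraMap A (AdicCompletion (maximalIdeal A) A) e ∈
        maximalIdeal (AdicCompletion (maximalIdeal A) A) ^ i := by
      rw [hmap]
      exact Ideal.mem_map_of_mem _ (Ideal.pow_le_pow_right (Nat.le_add_left _ _) he)
    have h3 := add_mem h1 h2
    rw [← hte, map_add] at h3
    convert h3 using 1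
    ring

/-- In an analytically unramified local domain, the integral closures of the powers of a principal
ideal are small. -/
lemma exists_spanIntegralClosure_pow_le [IsDomain A]
    [IsReduced (AdicCompletion (maximalIdeal A) A)]
    [Module.Flat A (AdicCompletion (maximalIdeal A) A)] {x : A} (hx : x ≠ 0)
    (hxm : x ∈ maximalIdeal A) (k : ℕ) :
    ∃ n, spanIntegralClosure (x ^ n) (pow_ne_zero n hx) ≤ maximalIdeal A ^ k := by
  by_contra! hcon
  obtain ⟨c, hc, hcT⟩ := exists_adicCompletion_mem_closure (spanIntegralClosure_pow_antitone hx) hcon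
  let C := AdicCompletion (maximalIdeal A) A
  have : IsNoetherianRing C := isNoetherianRing_adicCompletion _
  have hxc : algebraMap A C x * c ≠ 0 := by
    intro h
    refine hc ?_
    have := Module.Flat.isSMulRegular_of_nonZeroDivisors (M := C) (mem_nonZeroDivisors_of_ne_zero hx)
    exact this (by simpa [Algebra.smul_def] using h)
  -- As `C` is reduced, the nonzero element x c survives in some domain C/P, where
  -- `exists_not_isIntegralOverSpan_pow` applies.
  obtain ⟨P, hP, hxP⟩ : ∃ P : Ideal C, P.IsPrime ∧ algebraMap A C x * c ∉ P := by
    by_contra! hcon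
    refine hxc (IsReduced.eq_zero _ (nilpotent_iff_mem_prime.mpr fun P hP ↦ hcon P hP))
  let π := Ideal.Quotient.mk P
  have hπ : Function.Surjective π := Ideal.Quotient.mk_surjective
  have : IsLocalRing (C ⧸ P) := IsLocalRing.of_surjective' π hπ
  have hπm := map_mem_maximalIdeal_of_surjective hπ
  have hx' : π (algebraMap A C x) ≠ 0 := fun h ↦
    hxP (P.mul_mem_right _ (Ideal.Quotient.eq_zero_iff_mem.mp h))
  have hc' : π c ≠ 0 := fun h ↦ hxP (P.mul_mem_left _ (Ideal.Quotient.eq_zero_iff_mem.mp h))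
  have hxm' : π (algebraMap A C x) ∈ maximalIdeal (C ⧸ P) :=
    hπm (Ideal.mem_map_of_mem _ (by
      rw [AdicCompletion.maximalIdeal_eq_map]
      exact Ideal.mem_map_of_mem _ hxm))
  obtain ⟨n, hn⟩ := exists_not_isIntegralOverSpan_pow hx' hxm' hc'
  refine hn ?_
  let T := spanIntegralClosure (π (algebraMap A C x) ^ n) (pow_ne_zero n hx')
  change π c ∈ T
  -- By Krull's intersection theorem `T` is closed, so it contains the image of `c`, a limit of its
  -- elements.
  rw [← Ideal.Quotient.eq_zero_iff_mem]
  have : IsHausdorff (maximalIdeal (C ⧸ P)) ((C ⧸ P) ⧸ T) := inferInstance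
  refine this.haus _ fun i ↦ ?_
  obtain ⟨a, ha, hca⟩ := hcT n i
  have haT : π (algebraMap A C a) ∈ T := by
    have := IsIntegralOverSpan.map ha (π.comp (algebraMap A C))
    rwa [map_pow] at this
  have hd : π (c - algebraMap A C a) ∈ maximalIdeal (C ⧸ P) ^ i :=
    Ideal.pow_right_mono hπm i (by
      rw [← Ideal.map_pow]
      exact Ideal.mem_map_of_mem _ hca)
  rw [SModEq.zero]
  have h1 : Ideal.Quotient.mk T (π c) = π (c - algebraMap A C a) • (1 : (C ⧸ P) ⧸ T) := by
    rw [Algebra.smul_def, mul_one, Ideal.Quotient.algebraMap_eq, Ideal.Quotient.eq]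
    simpa using haT
  rw [h1]
  exact Submodule.smul_mem_smul hd Submodule.mem_top

end Chevalley

/-! ### Finiteness of the integral closure -/

section FiniteNormalization

open IsLocalRing

variable {R : Type u} [CommRing R] [IsDomain R]

/-- If `R` is analytically unramified at all primes containing `x`, then the integral closure of
the ideal generated by some power of `x` is contained in the ideal generated by `x`. -/
lemma exists_spanIntegralClosure_pow_le_span [IsNoetherianRing R] {x : R} (hx : x ≠ 0)
    (h : ∀ (p : Ideal R) [p.IsPrime], x ∈ p →
      IsReduced (AdicCompletion (maximalIdeal (Localization.AtPrime p)) (Localization.AtPrime p)) ∧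
      Module.Flat (Localization.AtPrime p)
        (AdicCompletion (maximalIdeal (Localization.AtPrime p)) (Localization.AtPrime p))) :
    ∃ n, spanIntegralClosure (x ^ n) (pow_ne_zero n hx) ≤ Ideal.span {x} := by
  -- The inclusion is tested on the primary components of (x), each containing a power of its
  -- radical.
  obtain ⟨t, ht, hprim⟩ := Submodule.isLasker R R (Ideal.span {x})
  have hQ : ∀ Q ∈ t, ∃ n, spanIntegralClosure (x ^ n) (pow_ne_zero n hx) ≤ Q := by
    intro (Q : Ideal R) hQt
    have hQ : Ideal.IsPrimary Q := hprim hQt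
    have hxQ : x ∈ Q := by
      have : Ideal.span {x} ≤ Q := ht ▸ Finset.inf_le (f := id) hQt
      exact this (Ideal.mem_span_singleton_self x)
    have hp : Q.radical.IsPrime := Ideal.isPrime_radical hQ
    obtain ⟨hred, hflat⟩ := h Q.radical (Ideal.le_radical hxQ)
    obtain ⟨k, hk⟩ := Q.exists_radical_pow_le_of_fg Q.radical.fg_of_isNoetherianRing
    let A := Localization.AtPrime Q.radical
    have hinj : Function.Injective (algebraMap R A) :=
      IsLocalization.injective A Q.radical.primeCompl_le_nonZeroDivisors
    have hx' : algebraMap R A x ≠ 0 := by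
      rwa [Ne, map_eq_zero_iff _ hinj]
    have hxm : algebraMap R A x ∈ maximalIdeal A := by
      rw [← Localization.AtPrime.map_eq_maximalIdeal]
      exact Ideal.mem_map_of_mem _ (Ideal.le_radical hxQ)
    obtain ⟨n, hn⟩ := exists_spanIntegralClosure_pow_le hx' hxm k
    refine ⟨n, fun a ha ↦ ?_⟩
    have h1 : algebraMap R A a ∈ maximalIdeal A ^ k := hn (by
      have := IsIntegralOverSpan.map ha (algebraMap R A)
      rwa [map_pow] at this)
    rw [← Localization.AtPrime.map_eq_maximalIdeal, ← Ideal.map_pow] at h1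
    have h2 := Ideal.map_mono (f := algebraMap R A) hk h1
    obtain ⟨⟨⟨q, hq⟩, s⟩, hqs⟩ := (IsLocalization.mem_map_algebraMap_iff Q.radical.primeCompl A).mp h2
    have h3 : a * s = q := hinj (by rw [map_mul]; exact hqs)
    exact ((Ideal.isPrimary_iff.mp hQ).2 (h3 ▸ hq : a * s ∈ Q)).resolve_right s.2
  choose! n hn using hQ
  refine ⟨t.sup n, ?_⟩
  rw [← ht]
  refine Finset.le_inf fun Q hQ ↦ (spanIntegralClosure_pow_antitone hx (Finset.le_sup hQ)).trans ?_
  exact hn Q hQ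

/-- If all localizations of `R` at primes not containing `x` are integrally closed, then every
integral element of the fraction field has a power of `x` as a denominator. -/
lemma exists_pow_mul_eq_algebraMap {K : Type*} [Field K] [Algebra R K] [IsFractionRing R K] {x : R}
    (h : ∀ (p : Ideal R) [p.IsPrime], x ∉ p → IsIntegrallyClosed (Localization.AtPrime p))
    {b : K} (hb : IsIntegral R b) : ∃ (N : ℕ) (a : R), algebraMap R K x ^ N * b = algebraMap R K a := by
  let D : Ideal R := (LinearMap.range (Algebra.linearMap R K)).comap (LinearMap.toSpanSingleton R K b)
  have hD : ∀ a, a ∈ D ↔ ∃ r, algebraMap R K r = algebraMap R K a * b := by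
    intro a
    simp [D, Algebra.smul_def]
  -- `D` is the ideal of denominators of `b`. If x ∉ p, then R_p is normal, so b ∈ R_p and D ⊄ p.
  suffices x ∈ D.radical by
    obtain ⟨N, hN⟩ := this
    obtain ⟨a, ha⟩ := (hD _).mp hN
    exact ⟨N, a, by rw [ha, map_pow]⟩
  rw [Ideal.radical_eq_sInf, Ideal.mem_sInf]
  rintro p ⟨hDp, hp⟩
  by_contra hxp
  have := h p hxp
  let A := Localization.AtPrime p
  have hinj : Function.Injective (algebraMap R A) :=
    IsLocalization.injective A p.primeCompl_le_nonZeroDivisors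
  obtain ⟨u, v, hv, rfl⟩ := IsFractionRing.div_surjective R b
  have hv0 : v ≠ 0 := nonZeroDivisors.ne_zero hv
  have hv' : algebraMap R K v ≠ 0 := by simpa using hv0
  obtain ⟨f, hf, hfr⟩ := ((isIntegralOverSpan_iff K hv0 u).mpr hb).map (algebraMap R A)
  obtain ⟨w, hw⟩ := dvd_of_isRoot_scaleRoots hf hfr
  obtain ⟨⟨w, s⟩, hws⟩ := IsLocalization.surj p.primeCompl w
  have h1 : u * s = v * w := hinj (by
    rw [map_mul, map_mul, hw, mul_assoc]
    exact congrArg _ hws)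
  refine s.2 (hDp ((hD _).mpr ⟨w, ?_⟩))
  have h2 := congrArg (algebraMap R K) h1
  rw [map_mul, map_mul] at h2
  field_simp
  linear_combination -h2

/-- An excellent domain has finite integral closure in its field of fractions. -/
theorem IsExcellentRing.finite_of_isIntegralClosure (hR : IsExcellentRing R) (K S : Type*) [Field K]
    [Algebra R K] [IsFractionRing R K] [CommRing S] [Algebra R S] [Algebra S K]
    [IsScalarTower R S K] [IsIntegralClosure S R K] : Module.Finite R S := by
  have := hR.isNoetherianRing
  obtain ⟨x, hx, hreg⟩ : ∃ x : R, x ≠ 0 ∧ ∀ (p : Ideal R) [p.IsPrime], x ∉ p →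
      IsIntegrallyClosed (Localization.AtPrime p) := by
    -- The generic point is regular, so by openness a basic neighbourhood of it is regular too.
    have hopen : IsOpen (regularLocus R) := hR.isJTwoRing R inferInstance
    have hmem : (⊥ : PrimeSpectrum R) ∈ regularLocus R := by
      let : Field (Localization.AtPrime (⊥ : Ideal R)) := IsField.toField <| by
        simp [isField_iff_maximalIdeal_eq, ← Localization.AtPrime.map_eq_maximalIdeal]
      exact inferInstanceAs (IsRegularLocalRing (Localization.AtPrime (⊥ : Ideal R)))
    obtain ⟨_, ⟨x, rfl⟩, hx, hsub⟩ :=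
      PrimeSpectrum.isTopologicalBasis_basic_opens.exists_subset_of_mem_open hmem hopen
    refine ⟨x, fun h ↦ hx (by simp [h]), fun p hp hxp ↦ ?_⟩
    have : IsRegularLocalRing (Localization.AtPrime p) := hsub (a := ⟨p, hp⟩) hxp
    exact (isDomain_and_isIntegrallyClosed_of_isRegularLocalRing (Localization.AtPrime p)).2
  obtain ⟨n, hn⟩ := exists_spanIntegralClosure_pow_le_span hx fun p hp _ ↦
    ⟨(hR.isGrothendieckRing p).isReduced, (hR.isGrothendieckRing p).1⟩
  have hx' : algebraMap R K x ≠ 0 := by simpa using hx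
  have key : ∀ b : K, IsIntegral R b → ∀ N : ℕ, ∀ a : R, algebraMap R K x ^ N * b = algebraMap R K a →
      ∃ a : R, algebraMap R K x ^ n * b = algebraMap R K a := by
    intro b hb N
    induction N with
    | zero => exact fun a ha ↦ ⟨x ^ n * a, by rw [map_mul, map_pow, ← ha, pow_zero, one_mul]⟩
    | succ N ih =>
      intro a ha
      -- For N ≥ n the quotient a / x^n = x^(N+1-n) b is integral. Hence a ∈ (x) by the choice of
      -- `n`, and one factor x cancels.
      rcases le_or_gt n N with hnN | hnN
      · have hint : a ∈ spanIntegralClosure (x ^ n) (pow_ne_zero n hx) := by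
          rw [mem_spanIntegralClosure, isIntegralOverSpan_iff K (pow_ne_zero n hx), ← ha, map_pow]
          have : algebraMap R K x ^ (N + 1) * b / algebraMap R K x ^ n =
              algebraMap R K (x ^ (N + 1 - n)) * b := by
            obtain ⟨d, rfl⟩ := Nat.exists_eq_add_of_le hnN
            rw [show n + d + 1 - n = d + 1 by omega, map_pow, add_assoc, pow_add]
            field_simp
          rw [this]
          exact isIntegral_algebraMap.mul hb
        obtain ⟨a', rfl⟩ := Ideal.mem_span_singleton.mp (hn hint)
        refine ih a' (mul_left_cancel₀ hx' ?_)
        rw [← map_mul, ← ha, pow_succ]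
        ring
      · refine ⟨x ^ (n - (N + 1)) * a, ?_⟩
        rw [map_mul, ← ha, map_pow, ← mul_assoc, ← pow_add, Nat.sub_add_cancel hnN]
  let ψ : S →ₗ[R] K := (LinearMap.mulLeft R (algebraMap R K x ^ n)) ∘ₗ
    (IsScalarTower.toAlgHom R S K).toLinearMap
  have hψ : ∀ s, ψ s ∈ LinearMap.range (Algebra.linearMap R K) := by
    intro s
    have hs : IsIntegral R (algebraMap S K s) :=
      (IsIntegralClosure.isIntegral_iff (A := S)).mpr ⟨s, rfl⟩
    obtain ⟨N, a, ha⟩ := exists_pow_mul_eq_algebraMap hreg hs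
    obtain ⟨a', ha'⟩ := key _ hs N a ha
    exact ⟨a', by simp [ψ, ha']⟩
  have : IsNoetherian R (LinearMap.range (Algebra.linearMap R K)) :=
    isNoetherian_of_surjective _ (LinearMap.range_rangeRestrict _)
  refine Module.Finite.of_injective (ψ.codRestrict _ hψ) fun s t hst ↦ ?_
  have h1 : ψ s = ψ t := congrArg Subtype.val hst
  exact IsIntegralClosure.algebraMap_injective S R K (mul_left_cancel₀ (pow_ne_zero n hx') h1)

end FiniteNormalization

/-! ### Embedding torsionfree modules into free modules -/

section Embedding

/-- A finitely generated torsionfree module over a domain embeds into its base change to the field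
of fractions. -/
lemma injective_mk_one_of_isTorsionFree {D : Type*} (K N : Type*) [CommRing D] [IsDomain D] [Field K]
    [Algebra D K] [IsFractionRing D K] [AddCommGroup N] [Module D N] [Module.IsTorsionFree D N] :
    Function.Injective (TensorProduct.mk D K N 1) := by
  have : IsLocalizedModule (nonZeroDivisors D) (TensorProduct.mk D K N 1) :=
    (isLocalizedModule_iff_isBaseChange (nonZeroDivisors D) K _).mpr
      (TensorProduct.isBaseChange D N K)
  rw [injective_iff_map_eq_zero]
  intro n hn
  obtain ⟨d, hd⟩ := (IsLocalizedModule.eq_zero_iff (nonZeroDivisors D) _).mp hn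
  exact (smul_eq_zero.mp hd).resolve_left (nonZeroDivisors.ne_zero d.2)

/-- A finitely generated torsionfree module over a domain embeds into a finite free module. -/
lemma exists_injective_pi_of_isTorsionFree (D N : Type*) [CommRing D] [IsDomain D] [AddCommGroup N]
    [Module D N] [Module.Finite D N] [Module.IsTorsionFree D N] :
    ∃ (n : ℕ) (f : N →ₗ[D] (Fin n → D)), Function.Injective f := by
  let K := FractionRing D
  let b := Module.finBasis K (K ⊗[D] N)
  let g : N →ₗ[D] (Fin _ → K) := (b.equivFun.toLinearMap.restrictScalars D) ∘ₗ TensorProduct.mk D K N 1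
  have hg : Function.Injective g :=
    b.equivFun.injective.comp (injective_mk_one_of_isTorsionFree K N)
  obtain ⟨s, hs⟩ := Module.Finite.fg_top (R := D) (M := N)
  -- A common denominator of the coordinates of the finitely many generators.
  obtain ⟨d, hd⟩ := IsLocalization.exist_integer_multiples (nonZeroDivisors D)
    (s ×ˢ Finset.univ) (fun p : N × Fin _ ↦ g p.1 p.2)
  have hd0 : (d : D) ≠ 0 := nonZeroDivisors.ne_zero d.2
  have hrange : ∀ n i, (d : D) • g n i ∈ LinearMap.range (Algebra.linearMap D K) := by
    intro n i
    have hn : n ∈ Submodule.span D (s : Set N) := hs ▸ Submodule.mem_top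
    induction hn using Submodule.span_induction with
    | mem x hx =>
      obtain ⟨a, ha⟩ := hd (x, i) (by simpa using hx)
      exact ⟨a, ha⟩
    | zero => simp
    | add x y _ _ hx hy =>
      rw [map_add, Pi.add_apply, smul_add]
      exact add_mem hx hy
    | smul a x _ hx =>
      rw [map_smul, Pi.smul_apply, smul_comm]
      exact Submodule.smul_mem _ _ hx
  let e : D ≃ₗ[D] LinearMap.range (Algebra.linearMap D K) :=
    LinearEquiv.ofInjective _ (IsFractionRing.injective D K)
  let h : ∀ i, N →ₗ[D] LinearMap.range (Algebra.linearMap D K) := fun i ↦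
    LinearMap.codRestrict _ ((d : D) • (LinearMap.proj i ∘ₗ g)) fun n ↦ hrange n i
  refine ⟨_, LinearMap.pi fun i ↦ e.symm.toLinearMap ∘ₗ h i, fun m n hmn ↦ hg (funext fun i ↦ ?_)⟩
  have h1 : h i m = h i n := e.symm.injective (congrFun hmn i)
  have h2 : (d : D) • g m i = (d : D) • g n i := congrArg Subtype.val h1
  exact smul_right_injective K hd0 h2

end Embedding

/-! ### Closure properties of IKE-closed subcategories -/

namespace IsIKEClosed

variable {R : Type u} [CommRing R] {X : ObjectProperty (ModuleCat.{u} R)} (hX : IsIKEClosed X)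
  {M N : Type u} [AddCommGroup M] [Module R M] [AddCommGroup N] [Module R N]

include hX

lemma of_linearEquiv (e : M ≃ₗ[R] N) (h : X (ModuleCat.of R M)) : X (ModuleCat.of R N) :=
  hX.of_iso e.toModuleIso h

lemma finite (h : X (ModuleCat.of R M)) : Module.Finite R M := hX.le_isFG _ h

lemma range_mem (f : M →ₗ[R] N) (hM : X (ModuleCat.of R M)) (hN : X (ModuleCat.of R N)) :
    X (ModuleCat.of R (LinearMap.range f)) :=
  hX.image (M := ModuleCat.of R M) (N := ModuleCat.of R N) f hM hN

lemma ker_mem (f : M →ₗ[R] N) (hM : X (ModuleCat.of R M)) (hN : X (ModuleCat.of R N)) :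
    X (ModuleCat.of R (LinearMap.ker f)) :=
  hX.kernel (M := ModuleCat.of R M) (N := ModuleCat.of R N) f hM hN

lemma prod (hM : X (ModuleCat.of R M)) (hN : X (ModuleCat.of R N)) :
    X (ModuleCat.of R (M × N)) :=
  hX.extension (L := ModuleCat.of R M) (M := ModuleCat.of R (M × N)) (N := ModuleCat.of R N)
    (LinearMap.inl R M N) (LinearMap.snd R M N) LinearMap.inl_injective
    (LinearMap.exact_iff.mpr (LinearMap.range_inl R M N).symm)
    LinearMap.snd_surjective hM hN

lemma pi (n : ℕ) (hM : X (ModuleCat.of R M)) : X (ModuleCat.of R (Fin n → M)) := by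
  induction n with
  | zero =>
    -- The zero module enters as the kernel of an identity map.
    have : Subsingleton (LinearMap.ker (LinearMap.id : M →ₗ[R] M)) := by
      rw [LinearMap.ker_id]
      infer_instance
    exact hX.of_linearEquiv (LinearEquiv.ofSubsingleton _ _)
      (hX.ker_mem (LinearMap.id : M →ₗ[R] M) hM hM)
  | succ n ih => exact hX.of_linearEquiv (Fin.consLinearEquiv R fun _ ↦ M) (hX.prod hM ih)

/-- A finite presentation R^m → R^n → N → 0 exhibits Hom(N, M) as the kernel of a map M^n → M^m. -/
lemma linearMap [IsNoetherianRing R] [Module.Finite R N] (hM : X (ModuleCat.of R M)) :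
    X (ModuleCat.of R (N →ₗ[R] M)) := by
  have hfree : ∀ n : ℕ, X (ModuleCat.of R ((Fin n → R) →ₗ[R] M)) := fun n ↦
    hX.of_linearEquiv ((Pi.basisFun R (Fin n)).constr R) (hX.pi n hM)
  obtain ⟨n, p, hp⟩ := Module.Finite.exists_fin' R N
  obtain ⟨m, q, hq⟩ := Module.Finite.exists_fin' R (LinearMap.ker p)
  let c := LinearMap.lcomp R M ((LinearMap.ker p).subtype ∘ₗ q)
  have hc : LinearMap.range (LinearMap.lcomp R M p) = LinearMap.ker c := by
    ext f
    constructor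
    · rintro ⟨g, rfl⟩
      refine LinearMap.ext fun v ↦ ?_
      simp [c]
    · intro hf
      have hle : LinearMap.ker p ≤ LinearMap.ker f := fun v hv ↦ by
        obtain ⟨w, hw⟩ := hq ⟨v, hv⟩
        have := LinearMap.congr_fun hf w
        simpa [c, hw] using this
      refine ⟨(LinearMap.ker p).liftQ f hle ∘ₗ (p.quotKerEquivOfSurjective hp).symm.toLinearMap,
        LinearMap.ext fun v ↦ ?_⟩
      have h1 : (p.quotKerEquivOfSurjective hp).symm (p v) = (LinearMap.ker p).mkQ v := by
        rw [LinearEquiv.symm_apply_eq]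
        rfl
      simp [h1]
  have hinj : Function.Injective (LinearMap.lcomp R M p) := fun f g hfg ↦ by
    refine LinearMap.ext fun y ↦ ?_
    obtain ⟨v, rfl⟩ := hp y
    exact LinearMap.congr_fun hfg v
  exact hX.of_linearEquiv ((LinearEquiv.ofEq _ _ hc.symm).trans (LinearEquiv.ofInjective _ hinj).symm)
    (hX.ker_mem c (hfree n) (hfree m))

omit hX in
/-- If the zero ideal is the only associated prime of the modules in `X`, then all modules in `X`
are torsionfree. -/
lemma _root_.isTorsionFree_of_assPrimes [IsDomain R] [IsNoetherianRing R] (hA : assPrimes X ⊆ {⊥})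
    (hM : X (ModuleCat.of R M)) : Module.IsTorsionFree R M := by
  refine Module.IsTorsionFree.of_smul_eq_zero fun r m hrm ↦ ?_
  by_contra! h
  obtain ⟨p, hp, hle⟩ := exists_le_isAssociatedPrime_of_isNoetherianRing R m h.2
  have hp0 : p = ⊥ := hA ⟨ModuleCat.of R M, hM, hp⟩
  have : r ∈ p := hle (by simpa using hrm)
  exact h.1 (by simpa [hp0] using this)

end IsIKEClosed

/-! ### Integrality of traces -/

section Trace

open Polynomial

/-- The trace of an endomorphism of a finite-dimensional vector space that is integral over a
subring is integral over that subring. -/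
lemma isIntegral_trace_of_isIntegral {S K V : Type*} [CommRing S] [Field K] [Algebra S K]
    [AddCommGroup V] [Module K V] [Module.Finite K V] {f : Module.End K V}
    {g : S[X]} (hg : g.Monic) (hgf : aeval f (g.map (algebraMap S K)) = 0) :
    IsIntegral S (LinearMap.trace K V f) := by
  let L := AlgebraicClosure K
  have hint : IsIntegral S (algebraMap K L (LinearMap.trace K V f)) := by
    -- Over the algebraic closure the trace is the sum of the eigenvalues, each a root of `g`.
    rw [← LinearMap.trace_baseChange,
      Module.End.trace_eq_sum_roots_charpoly_of_splits (IsAlgClosed.splits _)]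
    refine IsIntegral.multiset_sum fun μ hμ ↦ ?_
    rw [mem_roots (LinearMap.charpoly_monic _).ne_zero, ← Module.End.hasEigenvalue_iff_isRoot_charpoly]
      at hμ
    obtain ⟨v, hv⟩ := hμ.exists_hasEigenvector
    have h1 : aeval (f.baseChange L) ((g.map (algebraMap S K)).map (algebraMap K L)) = 0 := by
      rw [aeval_map_algebraMap]
      exact (aeval_algHom_apply (Module.End.baseChangeHom K L V) f _).trans (by rw [hgf, map_zero])
    have h2 := Module.End.aeval_apply_of_hasEigenvector (p := (g.map (algebraMap S K)).map (algebraMap K L)) hv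
    rw [h1, LinearMap.zero_apply] at h2
    have h3 := (smul_eq_zero.mp h2.symm).resolve_right hv.2
    refine ⟨g, hg, ?_⟩
    rw [Polynomial.map_map, Polynomial.eval_map] at h3
    exact h3
  exact (isIntegral_algHom_iff (IsScalarTower.toAlgHom S K L) (RingHom.injective _)).mp hint

end Trace

/-! ### Modules over rings between a domain and its fraction field -/

section FractionField

variable {R K S : Type*} [CommRing R] [IsDomain R] [Field K] [Algebra R K] [IsFractionRing R K]
  [CommRing S] [Algebra R S] [Algebra S K] [IsScalarTower R S K]

variable (R K) in
lemma exists_smul_eq_algebraMap (hinj : Function.Injective (algebraMap S K)) (s : S) :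
    ∃ d a : R, d ≠ 0 ∧ algebraMap R S d * s = algebraMap R S a := by
  obtain ⟨a, d, hd, h⟩ := IsFractionRing.div_surjective R (algebraMap S K s)
  have hd0 : algebraMap R K d ≠ 0 := by simpa using nonZeroDivisors.ne_zero hd
  refine ⟨d, a, nonZeroDivisors.ne_zero hd, hinj ?_⟩
  rw [map_mul, ← h, ← IsScalarTower.algebraMap_apply, ← IsScalarTower.algebraMap_apply,
    mul_div_cancel₀ _ hd0]

variable {N N' : Type*} [AddCommGroup N] [Module R N] [Module S N] [IsScalarTower R S N]
  [AddCommGroup N'] [Module R N'] [Module S N'] [IsScalarTower R S N']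

variable (R K) in
lemma isTorsionFree_of_isFractionRing (hinj : Function.Injective (algebraMap S K))
    [Module.IsTorsionFree R N] : Module.IsTorsionFree S N := by
  have : Nontrivial S := (algebraMap S K).domain_nontrivial
  refine Module.IsTorsionFree.of_smul_eq_zero fun s n hsn ↦ ?_
  obtain ⟨d, a, hd, h⟩ := exists_smul_eq_algebraMap R K hinj s
  have h1 : a • n = 0 := by
    rw [← algebraMap_smul S a n, ← h, mul_smul, hsn, smul_zero]
  rcases smul_eq_zero.mp h1 with rfl | hn
  · left
    apply hinj
    have h2 := congrArg (algebraMap S K) h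
    rw [map_mul, map_zero, map_zero, ← IsScalarTower.algebraMap_apply] at h2
    rw [map_zero]
    exact (mul_eq_zero.mp h2).resolve_left (by simpa using hd)
  · exact Or.inr hn

/-- Linear maps over a domain between torsionfree modules over a ring between the domain and its
field of fractions are linear over that ring. -/
lemma map_smul_of_isFractionRing (K : Type*) [Field K] [Algebra R K] [IsFractionRing R K]
    [Algebra S K] [IsScalarTower R S K] (hinj : Function.Injective (algebraMap S K))
    [Module.IsTorsionFree R N'] (φ : N →ₗ[R] N') (s : S) (n : N) : φ (s • n) = s • φ n := by
  obtain ⟨d, a, hd, h⟩ := exists_smul_eq_algebraMap R K hinj s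
  refine smul_right_injective N' hd ?_
  change d • φ (s • n) = d • s • φ n
  rw [← map_smul, ← algebraMap_smul S d (s • n), ← algebraMap_smul S d (s • φ n), smul_smul,
    smul_smul, h, algebraMap_smul, algebraMap_smul, map_smul]

end FractionField

/-- The module structure on the linear maps from a module over an algebra, by precomposition. -/
abbrev linearMapModule (R S N M : Type*) [CommRing R] [CommRing S] [Algebra R S] [AddCommGroup N]
    [Module R N] [Module S N] [IsScalarTower R S N] [AddCommGroup M] [Module R M] :
    Module S (N →ₗ[R] M) where
  smul s f := f ∘ₗ Algebra.lsmul R R N s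
  one_smul f := LinearMap.ext fun n ↦ congrArg f (one_smul S n)
  mul_smul s t f := LinearMap.ext fun n ↦ congrArg f (by
    change (s * t) • n = t • s • n
    rw [smul_smul, mul_comm])
  smul_zero s := rfl
  smul_add s f g := rfl
  add_smul s t f := LinearMap.ext fun n ↦ (congrArg f (add_smul s t n)).trans (map_add f _ _)
  zero_smul f := LinearMap.ext fun n ↦ (congrArg f (zero_smul S n)).trans (map_zero f)

lemma isScalarTower_linearMapModule (R S N M : Type*) [CommRing R] [CommRing S] [Algebra R S]
    [AddCommGroup N] [Module R N] [Module S N] [IsScalarTower R S N] [AddCommGroup M] [Module R M] :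
    letI := linearMapModule R S N M
    IsScalarTower R S (N →ₗ[R] M) :=
  letI := linearMapModule R S N M
  ⟨fun r s f ↦ LinearMap.ext fun n ↦ (congrArg f (smul_assoc r s n)).trans (map_smul f r (s • n))⟩

lemma isTorsionFree_linearMap (R N M : Type*) [CommRing R] [IsDomain R] [AddCommGroup N]
    [Module R N] [AddCommGroup M] [Module R M] [Module.IsTorsionFree R M] :
    Module.IsTorsionFree R (N →ₗ[R] M) :=
  Function.Injective.moduleIsTorsionFree (fun f : N →ₗ[R] M ↦ (f : N → M)) DFunLike.coe_injective
    fun _ _ ↦ rfl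

/-! ### The integral closure as a member of an IKE-closed subcategory -/

namespace IsIKEClosed

variable {R : Type u} [CommRing R] [IsDomain R] [IsNoetherianRing R]
  {X : ObjectProperty (ModuleCat.{u} R)} (hX : IsIKEClosed X)

include hX

/-- If a nonzero ideal of the integral closure `S` belongs to an IKE-closed subcategory, so does
`S`. -/
lemma integralClosure_mem_of_ideal_mem {K S : Type u} [Field K] [Algebra R K] [IsFractionRing R K]
    [CommRing S] [Algebra R S] [Algebra S K] [IsScalarTower R S K] [IsIntegralClosure S R K]
    {J : Ideal S} (hJ : J ≠ ⊥) (h : X (ModuleCat.of R J)) : X (ModuleCat.of R S) := by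
  have hinj : Function.Injective (algebraMap S K) := IsIntegralClosure.algebraMap_injective S R K
  have : IsDomain S := hinj.isDomain (algebraMap S K)
  have : Module.IsTorsionFree R S := by
    refine Module.IsTorsionFree.of_smul_eq_zero fun r s hrs ↦ ?_
    rw [Algebra.smul_def, mul_eq_zero] at hrs
    refine hrs.imp_left fun hr ↦ ?_
    have := congrArg (algebraMap S K) hr
    rwa [← IsScalarTower.algebraMap_apply, map_zero, map_eq_zero_iff _ (IsFractionRing.injective R K)]
      at this
  have : Module.IsTorsionFree R J :=
    Function.Injective.moduleIsTorsionFree (fun j : J ↦ (j : S)) Subtype.val_injective fun _ _ ↦ rfl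
  have : Module.Finite R J := hX.finite h
  obtain ⟨j₀, hj₀, hj₀'⟩ := J.ne_bot_iff.mp hJ
  have hj₀K : algebraMap S K j₀ ≠ 0 := by
    rwa [Ne, map_eq_zero_iff _ hinj]
  -- Multiplication identifies `S` with Hom_R(J, J): an endomorphism `f` is `S`-linear, hence
  -- multiplication by f(j₀)/j₀, which is integral because it preserves the finitely generated
  -- module `J`.
  refine hX.of_linearEquiv (LinearEquiv.ofBijective (Algebra.lsmul R R J : S →ₐ[R] _).toLinearMap
    ⟨?_, ?_⟩).symm (hX.linearMap (N := J) h)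
  · rw [injective_iff_map_eq_zero]
    intro s hs
    have h1 : s * j₀ = 0 := congrArg Subtype.val (LinearMap.congr_fun hs ⟨j₀, hj₀⟩)
    exact (mul_eq_zero.mp h1).resolve_right hj₀'
  · intro f
    have hf : ∀ (s : S) (j : J), f (s • j) = s • f j := map_smul_of_isFractionRing K hinj f
    have hfj : ∀ j : J, (j₀ * f j : S) = f ⟨j₀, hj₀⟩ * j := fun j ↦ by
      have h1 : j₀ • j = (j : S) • (⟨j₀, hj₀⟩ : J) := Subtype.ext (mul_comm _ _)
      have h2 := congrArg Subtype.val (congrArg f h1)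
      rw [hf, hf] at h2
      simpa [mul_comm] using h2
    let ι : J →ₗ[R] K := (IsScalarTower.toAlgHom R S K).toLinearMap ∘ₗ
      (J.subtype.restrictScalars R)
    have hι : ∀ j : J, ι j = algebraMap S K j := fun j ↦ rfl
    have hint : IsIntegral R (algebraMap S K (f ⟨j₀, hj₀⟩) / algebraMap S K j₀) := by
      refine isIntegral_of_smul_mem_submodule (LinearMap.range ι) ?_ ?_ _ ?_
      · exact (Submodule.ne_bot_iff _).mpr ⟨_, ⟨⟨j₀, hj₀⟩, rfl⟩, hj₀K⟩
      · exact LinearMap.range_eq_map ι ▸ Submodule.FG.map _ Module.Finite.fg_top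
      · rintro _ ⟨j, rfl⟩
        refine ⟨f j, ?_⟩
        rw [hι, hι, smul_eq_mul, div_mul_eq_mul_div, eq_div_iff hj₀K, ← map_mul, ← map_mul, ← hfj,
          mul_comm]
    obtain ⟨s, hs⟩ := (IsIntegralClosure.isIntegral_iff (A := S)).mp hint
    refine ⟨s, LinearMap.ext fun j ↦ Subtype.ext (hinj ?_)⟩
    have h3 := congrArg (algebraMap S K) (hfj j)
    rw [map_mul, map_mul] at h3
    change algebraMap S K (s * j) = _
    rw [map_mul, hs, div_mul_eq_mul_div, div_eq_iff hj₀K, ← h3, mul_comm]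

end IsIKEClosed

lemma IsAssociatedPrime.eq_bot_of_isTorsionFree {R M : Type*} [CommRing R] [IsDomain R]
    [IsNoetherianRing R] [AddCommGroup M] [Module R M] [Module.IsTorsionFree R M] {p : Ideal R}
    (h : IsAssociatedPrime p M) : p = ⊥ := by
  obtain ⟨hp, x, rfl⟩ := isAssociatedPrime_iff.mp h
  have hx : x ≠ 0 := by
    rintro rfl
    exact hp.ne_top (by simp)
  refine (Submodule.eq_bot_iff _).mpr fun r hr ↦ ?_
  rw [Submodule.mem_colon_singleton, Submodule.mem_bot] at hr
  exact (smul_eq_zero.mp hr).resolve_right hx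

namespace IsIKEClosed

variable {R : Type u} [CommRing R] [IsDomain R] [IsNoetherianRing R]
  {X : ObjectProperty (ModuleCat.{u} R)} (hX : IsIKEClosed X)

include hX

/-- If an IKE-closed subcategory contains a nonzero torsionfree module over the integral closure `S`,
then it contains a nonzero ideal of `S`, namely the image of the trace. -/
lemma exists_ideal_mem [CharZero R] {K S N : Type u} [Field K] [Algebra R K] [IsFractionRing R K]
    [CommRing S] [Algebra R S] [Algebra S K] [IsScalarTower R S K] [IsIntegralClosure S R K]
    [AddCommGroup N] [Module R N] [Module S N] [IsScalarTower R S N] [Module.IsTorsionFree R N]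
    [Nontrivial N] (h : X (ModuleCat.of R N)) : ∃ J : Ideal S, J ≠ ⊥ ∧ X (ModuleCat.of R J) := by
  have hinj : Function.Injective (algebraMap S K) := IsIntegralClosure.algebraMap_injective S R K
  have : IsDomain S := hinj.isDomain (algebraMap S K)
  have : Module.IsTorsionFree S N := isTorsionFree_of_isFractionRing R K hinj
  have : Module.Finite R N := hX.finite h
  have : Module.Finite S N := Module.Finite.of_restrictScalars_finite R S N
  have : Algebra.IsIntegral R S := IsIntegralClosure.isIntegral_algebra R K
  have : Algebra.IsAlgebraic R K := IsLocalization.isAlgebraic K (nonZeroDivisors R)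
  have : IsFractionRing S K := IsIntegralClosure.isFractionRing_of_algebraic R S
    fun x hx ↦ (map_eq_zero_iff _ (IsFractionRing.injective R K)).mp hx
  have : CharZero K := charZero_of_injective_algebraMap (IsFractionRing.injective R K)
  let toS : (N →ₗ[R] N) → Module.End S N := fun φ ↦
    { φ with map_smul' := map_smul_of_isFractionRing K hinj φ }
  let τ : Module.End S N →ₗ[S] K := (LinearMap.trace K (K ⊗[S] N)).restrictScalars S ∘ₗ
    (Module.End.baseChangeHom S K N).toLinearMap
  have hτ : ∀ g, ∃ s, algebraMap S K s = τ g := fun g ↦ by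
    obtain ⟨f, hf, hfg⟩ := Algebra.IsIntegral.isIntegral (R := S) g
    have h1 : Polynomial.aeval (Module.End.baseChangeHom S K N g) (f.map (algebraMap S K)) = 0 := by
      rw [Polynomial.aeval_map_algebraMap]
      exact (Polynomial.aeval_algHom_apply (Module.End.baseChangeHom S K N) g f).trans (by
        rw [Polynomial.aeval_def, hfg, map_zero])
    exact (IsIntegralClosure.isIntegral_iff (R := R) (A := S)).mp
      (isIntegral_trans _ (isIntegral_trace_of_isIntegral hf h1))
  choose t ht using hτ
  let t' : (N →ₗ[R] N) →ₗ[R] S :=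
    { toFun φ := t (toS φ)
      map_add' φ ψ := hinj (by
        rw [map_add, ht, ht, ht, ← map_add]
        rfl)
      map_smul' r φ := hinj (by
        have hr : toS (r • φ) = algebraMap R S r • toS φ := by
          ext n
          exact (algebraMap_smul S r (φ n)).symm
        rw [RingHom.id_apply, Algebra.smul_def r (t (toS φ)), map_mul, ht, ht, hr, map_smul,
          Algebra.smul_def (algebraMap R S r)]) }
  let J : Ideal S :=
    { carrier := Set.range t'
      zero_mem' := ⟨0, map_zero _⟩
      add_mem' := by
        rintro _ _ ⟨φ, rfl⟩ ⟨ψ, rfl⟩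
        exact ⟨φ + ψ, map_add _ _ _⟩
      smul_mem' := by
        rintro s _ ⟨φ, rfl⟩
        refine ⟨(s • toS φ).restrictScalars R, hinj ?_⟩
        change algebraMap S K (t (s • toS φ)) = algebraMap S K (s * t (toS φ))
        rw [ht, map_mul, ht, map_smul, Algebra.smul_def] }
  refine ⟨J, fun hJ ↦ ?_, ?_⟩
  -- The trace of the identity is the rank of `N`, nonzero in characteristic zero.
  · have h1 : t' LinearMap.id ∈ J := ⟨_, rfl⟩
    rw [hJ, Ideal.mem_bot] at h1
    have h2 : τ (toS LinearMap.id) = 0 := by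
      rw [← ht]
      exact (congrArg _ h1).trans (map_zero _)
    have h3 : τ (toS LinearMap.id) = Module.finrank K (K ⊗[S] N) := by
      have : Module.End.baseChangeHom S K N (toS LinearMap.id) = 1 := map_one _
      change LinearMap.trace K (K ⊗[S] N) (Module.End.baseChangeHom S K N (toS LinearMap.id)) = _
      rw [this, LinearMap.trace_one]
    rw [h3, Nat.cast_eq_zero] at h2
    have : Nontrivial (K ⊗[S] N) := (injective_mk_one_of_isTorsionFree K N).nontrivial
    exact Module.finrank_pos.ne' h2
  -- The target `S` of the trace is not yet known to lie in `X`. The faithful action of `S` on `N`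
  -- makes `J` the image of an endomorphism of End_R(N), which does.
  · let ι : S →ₗ[R] (N →ₗ[R] N) := (Algebra.lsmul R R N).toLinearMap
    let e : J →ₗ[R] (N →ₗ[R] N) := ι ∘ₗ J.subtype.restrictScalars R
    have he : Function.Injective e := by
      rw [injective_iff_map_eq_zero]
      intro j hj
      obtain ⟨n, hn⟩ := exists_ne (0 : N)
      exact Subtype.ext ((smul_eq_zero.mp (LinearMap.congr_fun hj n)).resolve_right hn)
    have hrange : LinearMap.range (ι ∘ₗ t') = LinearMap.range e := by
      ext f
      constructor
      · rintro ⟨φ, rfl⟩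
        exact ⟨⟨t' φ, φ, rfl⟩, rfl⟩
      · rintro ⟨⟨_, φ, rfl⟩, rfl⟩
        exact ⟨φ, rfl⟩
    have hE := hX.linearMap (N := N) h
    exact hX.of_linearEquiv ((LinearEquiv.ofEq _ _ hrange).trans (LinearEquiv.ofInjective e he).symm)
      (hX.range_mem (ι ∘ₗ t') hE hE)

/-- An IKE-closed subcategory whose only associated prime is zero contains the integral closure `S`
of `R`, if `S` is finite over `R`. -/
lemma integralClosure_mem [CharZero R] {K S : Type u} [Field K] [Algebra R K] [IsFractionRing R K]
    [CommRing S] [Algebra R S] [Algebra S K] [IsScalarTower R S K] [IsIntegralClosure S R K]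
    [Module.Finite R S] (hA : assPrimes X = {⊥}) : X (ModuleCat.of R S) := by
  have hinj : Function.Injective (algebraMap S K) := IsIntegralClosure.algebraMap_injective S R K
  obtain ⟨M, hM, hbot⟩ : (⊥ : Ideal R) ∈ assPrimes X := hA ▸ Set.mem_singleton _
  have hM' : X (ModuleCat.of R M) := hM
  have : Nontrivial M := by
    by_contra hcon
    rw [not_nontrivial_iff_subsingleton] at hcon
    exact not_isAssociatedPrime_of_subsingleton hbot
  have : Module.IsTorsionFree R M := isTorsionFree_of_assPrimes hA.subset hM'
  have : Module.IsTorsionFree R (S →ₗ[R] M) := isTorsionFree_linearMap R S M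
  have hRS : Function.Injective (algebraMap R S) := by
    refine Function.Injective.of_comp (f := algebraMap S K) ?_
    rw [← RingHom.coe_comp, ← IsScalarTower.algebraMap_eq]
    exact IsFractionRing.injective R K
  have : IsDomain S := hinj.isDomain (algebraMap S K)
  have : Module.IsTorsionFree R S := by
    refine Module.IsTorsionFree.of_smul_eq_zero fun r s hrs ↦ ?_
    rw [Algebra.smul_def, mul_eq_zero, map_eq_zero_iff _ hRS] at hrs
    exact hrs
  -- `S` embeds in a free `R`-module; a coordinate not vanishing at 1 gives a nonzero map to `M`.
  have : Nontrivial (S →ₗ[R] M) := by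
    obtain ⟨n, f, hf⟩ := exists_injective_pi_of_isTorsionFree R S
    obtain ⟨i, hi⟩ : ∃ i, f 1 i ≠ 0 := Function.ne_iff.mp ((map_ne_zero_iff f hf).mpr one_ne_zero)
    obtain ⟨m, hm⟩ := exists_ne (0 : M)
    refine ⟨⟨(LinearMap.toSpanSingleton R M m) ∘ₗ (LinearMap.proj i) ∘ₗ f, 0, fun h ↦ ?_⟩⟩
    exact smul_ne_zero hi hm (LinearMap.congr_fun h 1)
  let := linearMapModule R S S M
  have := isScalarTower_linearMapModule R S S M
  obtain ⟨J, hJ, hJX⟩ := hX.exists_ideal_mem (K := K) (S := S) (hX.linearMap (N := S) hM')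
  exact hX.integralClosure_mem_of_ideal_mem (K := K) hJ hJX

omit [IsDomain R] [IsNoetherianRing R] in
/-- An IKE-closed subcategory containing an algebra `S` contains all finitely generated torsionfree
`S`-modules. -/
lemma mem_of_isTorsionFree {S M : Type u} [CommRing S] [IsDomain S] [Algebra R S]
    [AddCommGroup M] [Module R M] [Module S M] [IsScalarTower R S M] [Module.Finite S M]
    [Module.IsTorsionFree S M] (hS : X (ModuleCat.of R S)) : X (ModuleCat.of R M) := by
  obtain ⟨n, f, hf⟩ := exists_injective_pi_of_isTorsionFree S M
  obtain ⟨m, p, hp⟩ := Module.Finite.exists_fin' S M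
  -- `M` is the image of the composite S^m → M → S^n.
  have hrange : LinearMap.range ((f ∘ₗ p).restrictScalars R) =
      LinearMap.range (f.restrictScalars R) := by
    ext v
    constructor
    · rintro ⟨w, rfl⟩
      exact ⟨p w, rfl⟩
    · rintro ⟨w, rfl⟩
      obtain ⟨w, rfl⟩ := hp w
      exact ⟨w, rfl⟩
  exact hX.of_linearEquiv ((LinearEquiv.ofEq _ _ hrange).trans
    (LinearEquiv.ofInjective (f.restrictScalars R) hf).symm)
    (hX.range_mem ((f ∘ₗ p).restrictScalars R) (hX.pi m hS) (hX.pi n hS))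

/-- An IKE-closed subcategory whose only associated prime is zero contains all finitely generated
torsionfree modules over the integral closure `S` of `R`, if `S` is finite over `R`. -/
lemma mem_of_isIntegralClosure [CharZero R] (K S : Type u) [Field K] [Algebra R K]
    [IsFractionRing R K] [CommRing S] [Algebra R S] [Algebra S K] [IsScalarTower R S K]
    [IsIntegralClosure S R K] [Module.Finite R S] (hA : assPrimes X = {⊥})
    (M : Type u) [AddCommGroup M] [Module R M] [Module S M] [IsScalarTower R S M]
    [Module.Finite S M] [Module.IsTorsionFree S M] : X (ModuleCat.of R M) :=
  have : IsDomain S := (IsIntegralClosure.algebraMap_injective S R K).isDomain (algebraMap S K)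
  hX.mem_of_isTorsionFree (hX.integralClosure_mem (K := K) (S := S) hA)

end IsIKEClosed

theorem proposition4p6 (R : Type u) [CommRing R] [IsDomain R] [CharZero R]
    (hR : IsExcellentRing R) :
    (∀ (K S : Type u) [Field K] [Algebra R K] [IsFractionRing R K]
        [CommRing S] [Algebra R S] [Algebra S K] [IsScalarTower R S K] [IsIntegralClosure S R K]
        (X : ObjectProperty (ModuleCat.{u} R)), IsIKEClosed X → assPrimes X = {⊥} →
      (∀ (M : Type u) [AddCommGroup M] [Module R M] [Module S M] [IsScalarTower R S M],
        Module.Finite S M → Module.IsTorsionFree S M → X (ModuleCat.of R M)) ∧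
      (∀ (N : Type u) [AddCommGroup N] [Module R N] [Module S N] [IsScalarTower R S N],
        Module.Finite S N → X (ModuleCat.of R (N →ₗ[R] R)))) ∧
    (IsIntegrallyClosed R →
      ¬ ∃ X : ObjectProperty (ModuleCat.{u} R), IsIKEClosed X ∧
        zeroModules R < X ∧ X < torsionfreeModules R) := by
  have := hR.isNoetherianRing
  refine ⟨fun K S _ _ _ _ _ _ _ _ X hX hA ↦ ?_, ?_⟩
  · have := hR.finite_of_isIntegralClosure K S
    refine ⟨fun M _ _ _ _ hfin htf ↦ hX.mem_of_isIntegralClosure K S hA M,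
      fun N _ _ _ _ hfin ↦ ?_⟩
    -- The dual Hom_R(N, R) is itself a finitely generated torsionfree `S`-module, so the first
    -- claim covers it.
    have : Module.Finite R N := Module.Finite.trans S N
    let := linearMapModule R S N R
    have := isScalarTower_linearMapModule R S N R
    have : Module.IsTorsionFree R (N →ₗ[R] R) := isTorsionFree_linearMap R N R
    have : Module.IsTorsionFree S (N →ₗ[R] R) :=
      isTorsionFree_of_isFractionRing R K (IsIntegralClosure.algebraMap_injective S R K)
    have : Module.Finite R (N →ₗ[R] R) := inferInstance
    have : Module.Finite S (N →ₗ[R] R) := Module.Finite.of_restrictScalars_finite R S _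
    exact hX.mem_of_isIntegralClosure K S hA _
  · rintro hint ⟨X, hX, h0X, hXtf⟩
    have hA : assPrimes X = {⊥} := by
      refine Set.eq_singleton_iff_unique_mem.mpr ⟨?_, ?_⟩
      · obtain ⟨M, hM, hM0⟩ : ∃ M, X M ∧ ¬ zeroModules R M := by
          by_contra! hcon
          exact h0X.not_ge hcon
        have : Nontrivial M := not_subsingleton_iff_nontrivial.mp hM0
        have : Module.IsTorsionFree R M := (hXtf.le M hM).2
        obtain ⟨p, hp⟩ := associatedPrimes.nonempty R M
        rw [IsAssociatedPrime.eq_bot_of_isTorsionFree hp] at hp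
        exact ⟨M, hM, hp⟩
      · rintro p ⟨M, hM, hp⟩
        have : Module.IsTorsionFree R M := (hXtf.le M hM).2
        exact IsAssociatedPrime.eq_bot_of_isTorsionFree hp
    refine hXtf.not_ge fun M hM ↦ ?_
    have := hM.1
    have := hM.2
    -- A normal `R` is its own integral closure.
    exact hX.mem_of_isIntegralClosure (FractionRing R) R hA M
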